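/- Let $\mathbb Z^2$ denote the square lattice (the Cayley graph of the group $\mathbb Z^2$ with generators $(1,0),(0,1)$), and let $\mu$ be an edge percolation measure on it, i.e. a probability measure on $\{0,1\}^{E(\mathbb Z^2)}$ with the product $\sigma$-algebra; $\omega\in\{0,1\}^{E(\mathbb Z^2)}$ is identified with the spanning subgraph whose (open) edges are those $e$ with $\omega_e=1$. A cluster is a connected component of this subgraph, and it is infinite if it has infinitely many vertices. Let $\mu^*$ be the dual measure: the law of the dual subgraph $\omega^*$ of the planar dual lattice, in which a dual edge is open if and only if the edge that it crosses is closed in $\omega$. The planar dual lattice is identified with $\mathbb Z^2$ by identifying the plaquette centred at $(x+\tfrac12,y+\tfrac12)$ with the vertex $(x,y)$. Let $\mu_{\mathrm{hp}}$ and $\mu^*_{\mathrm{hp}}$ be the marginals of $\mu$ and of $\mu^*$ on the subgraph induced by the upper half-plane $\mathbb Z\times\mathbb Z_{\ge 0}$. Suppose that $\mu$ is invariant and ergodic under the action of $\mathbb Z^2$ by translations, and that $\mu$-almost surely there are only finitely many (possibly zero) infinite clusters. Then exactly one of the following holds: 1. almost surely $\mu_{\mathrm{hp}}$ has a unique infinite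 cluster and $\mu^*_{\mathrm{hp}}$ has no infinite cluster; 2. almost surely $\mu^*_{\mathrm{hp}}$ has a unique infinite cluster and $\mu_{\mathrm{hp}}$ has no infinite cluster; 3. almost surely neither $\mu_{\mathrm{hp}}$ nor $\mu^*_{\mathrm{hp}}$ has an infinite cluster. -/

import Mathlib

open MeasureTheory

namespace HalfPlanePercolation

/-! ### Configurations and clusters -/

section General

variable {V : Type*}

/-- The space `{0,1}^{E(G)}` of subgraphs of `G`; the value `true` means that the edge is open
(present). It carries the product σ-algebra. -/
abbrev EdgeConfig (G : SimpleGraph V) : Type _ := G.edgeSet → Bool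

/-- The spanning subgraph of `G` formed by the open edges of `ω`. -/
def openGraph {G : SimpleGraph V} (ω : EdgeConfig G) : SimpleGraph V :=
  SimpleGraph.fromEdgeSet {e | ∃ he : e ∈ G.edgeSet, ω ⟨e, he⟩ = true}

/-- The infinite clusters of `ω`: the connected components of the graph of open edges that
have infinitely many vertices. -/
def infiniteClusters {G : SimpleGraph V} (ω : EdgeConfig G) :
    Set (openGraph ω).ConnectedComponent :=
  {C | C.supp.Infinite}

/-- `ω` has finitely many (possibly zero) infinite clusters. -/
def FinitelyManyInfiniteClusters {G : SimpleGraph V} (ω : EdgeConfig G) : Prop :=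
  (infiniteClusters ω).Finite

/-- `ω` has exactly one infinite cluster. -/
def UniqueInfiniteCluster {G : SimpleGraph V} (ω : EdgeConfig G) : Prop :=
  ∃! C, C ∈ infiniteClusters ω

/-- `ω` has no infinite cluster. -/
def NoInfiniteCluster {G : SimpleGraph V} (ω : EdgeConfig G) : Prop :=
  infiniteClusters ω = ∅

/-- Almost surely, a random subgraph with law `ν` has exactly one infinite cluster. -/
def AlmostSurelyUnique {G : SimpleGraph V} (ν : Measure (EdgeConfig G)) : Prop :=
  ∀ᵐ ω ∂ν, UniqueInfiniteCluster ω

/-- Almost surely, a random subgraph with law `ν` has no infinite cluster. -/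
def AlmostSurelyNone {G : SimpleGraph V} (ν : Measure (EdgeConfig G)) : Prop :=
  ∀ᵐ ω ∂ν, NoInfiniteCluster ω

/-- The restriction of a configuration to the edges with both endpoints in `s`. -/
def restrictConfig {G : SimpleGraph V} (s : Set V) (ω : EdgeConfig G) :
    EdgeConfig (G.induce s) :=
  fun e => ω ((SimpleGraph.Embedding.induce s).mapEdgeSet e)

theorem measurable_restrictConfig {G : SimpleGraph V} (s : Set V) :
    Measurable (restrictConfig (G := G) s) :=
  measurable_pi_lambda _ fun _ => measurable_pi_apply _

end General

/-! ### The square lattice and its translations -/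

/-- The square lattice: the Cayley graph of `ℤ²` with generators `(1,0)` and `(0,1)`. -/
def squareLattice : SimpleGraph (ℤ × ℤ) := SimpleGraph.addCayley {(1, 0), (0, 1)}

theorem squareLattice_adj {p q : ℤ × ℤ} : squareLattice.Adj p q ↔
    q = p + (1, 0) ∨ q = p + (0, 1) ∨ p = q + (1, 0) ∨ p = q + (0, 1) := by
  obtain ⟨a, b⟩ := p
  obtain ⟨c, d⟩ := q
  rw [squareLattice, SimpleGraph.addCayley_adj']
  simp only [Set.mem_insert_iff, Set.mem_singleton_iff, exists_eq_or_imp, exists_eq_left, ne_eq]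
  simp only [Prod.ext_iff, Prod.fst_add, Prod.snd_add]
  omega

/-- Translation by `v` as an automorphism of the square lattice. -/
def translation (v : ℤ × ℤ) : squareLattice ≃g squareLattice where
  toEquiv := Equiv.addLeft v
  map_rel_iff' := by
    intro p q
    simp [squareLattice]

/-- The group `ℤ²` acts on configurations: the edge `e` is open in the translate `v +ᵥ ω` if and
only if the edge `e - v` is open in `ω`. -/
instance : AddAction (ℤ × ℤ) (EdgeConfig squareLattice) where
  vadd v ω := fun e => ω ((translation (-v)).mapEdgeSet e)
  zero_vadd ω := by
    funext e
    change ω _ = ω e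
    congr 1
    apply Subtype.ext
    obtain ⟨e, he⟩ := e
    induction e with
    | _ p q => simp [translation]
  add_vadd v w ω := by
    funext e
    change ω _ = ω _
    congr 1
    apply Subtype.ext
    obtain ⟨e, he⟩ := e
    induction e with
    | _ p q => simp [translation, add_assoc]

/-! ### Planar duality -/

/-- The four corners of the plaquette (unit square face) with lower left corner `p`. This plaquette
is centred at `p + (1/2, 1/2)`, and we label it by `p`; with this labelling the planar dual of the
square lattice is again `squareLattice`. -/
def corners (p : ℤ × ℤ) : Set (ℤ × ℤ) := {p, p + (1, 0), p + (0, 1), p + (1, 1)}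

/-- The edge of the square lattice crossed by the dual edge between the adjacent plaquettes
`p` and `q`. It is the edge shared by the two plaquettes; see `mem_crossedEdge`. -/
def crossedSym2 : Sym2 (ℤ × ℤ) → Sym2 (ℤ × ℤ) :=
  Sym2.lift ⟨fun p q => s(p ⊔ q, p ⊓ q + (1, 1)), fun p q => by
    simp only [sup_comm p q, inf_comm p q]⟩

theorem crossedSym2_mem (e : squareLattice.edgeSet) :
    crossedSym2 e ∈ squareLattice.edgeSet := by
  obtain ⟨e, he⟩ := e
  induction e with
  | _ p q =>
    obtain ⟨a, b⟩ := p
    obtain ⟨c, d⟩ := q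
    simp only [SimpleGraph.mem_edgeSet, squareLattice_adj, crossedSym2, Sym2.lift_mk,
      Prod.ext_iff, Prod.fst_add, Prod.snd_add, Prod.fst_sup, Prod.snd_sup, Prod.fst_inf,
      Prod.snd_inf] at he ⊢
    omega

/-- The natural map `E((ℤ²)*) → E(ℤ²)`, sending a dual edge to the edge that it crosses. -/
def crossedEdge (e : squareLattice.edgeSet) : squareLattice.edgeSet :=
  ⟨crossedSym2 e, crossedSym2_mem e⟩

/-- The edge crossed by the dual edge `s(p, q)` is the common side of the plaquettes
`p` and `q`: its endpoints are exactly their common corners. -/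
theorem mem_crossedEdge {p q : ℤ × ℤ} (h : squareLattice.Adj p q) (v : ℤ × ℤ) :
    v ∈ (crossedEdge ⟨s(p, q), h⟩ : Sym2 (ℤ × ℤ)) ↔ v ∈ corners p ∩ corners q := by
  obtain ⟨a, b⟩ := p
  obtain ⟨c, d⟩ := q
  obtain ⟨x, y⟩ := v
  simp only [squareLattice_adj, crossedEdge, crossedSym2, corners, Sym2.lift_mk, Sym2.mem_iff,
    Set.mem_inter_iff, Set.mem_insert_iff, Set.mem_singleton_iff, Prod.ext_iff, Prod.fst_add,
    Prod.snd_add, Prod.fst_sup, Prod.snd_sup, Prod.fst_inf, Prod.snd_inf] at h ⊢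
  omega

/-- The dual configuration: a dual edge is open if and only if the edge that it crosses is
closed. -/
def dualConfig (ω : EdgeConfig squareLattice) : EdgeConfig squareLattice :=
  fun e => !(ω (crossedEdge e))

theorem measurable_dualConfig : Measurable dualConfig :=
  measurable_pi_lambda _ fun _ => (measurable_of_finite _).comp (measurable_pi_apply _)

/-- The dual measure `μ*`, the law of the dual configuration. -/
noncomputable def dualMeasure (μ : Measure (EdgeConfig squareLattice)) :
    Measure (EdgeConfig squareLattice) :=
  μ.map dualConfig

/-! ### The upper half-plane -/

/-- The vertices `ℤ × ℤ_{≥ 0}` of the upper half-plane. -/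
def upperHalfPlane : Set (ℤ × ℤ) := {v | 0 ≤ v.2}

/-- The marginal `μ_hp` of an edge percolation measure on the upper half-plane, a measure on
configurations of the subgraph of the square lattice induced by the upper half-plane. -/
noncomputable def halfPlaneMarginal (μ : Measure (EdgeConfig squareLattice)) :
    Measure (EdgeConfig (squareLattice.induce upperHalfPlane)) :=
  μ.map (restrictConfig upperHalfPlane)

end HalfPlanePercolation

/-! The heart of the matter is non-coexistence (`ae_no_infinite_dual`): if half-planes contain
infinite primal clusters, they contain no infinite dual ones. A stationary random subset of ℤ has no
greatest element (`ae_not_isGreatest`), so if both kinds occurred, both would start from the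
boundary line arbitrarily far to the right. For primal clusters, reaching the boundary uses that no
infinite cluster of the plane is bounded below (`ae_not_bounded_below`): the lowest heights of such
clusters would form a finite stationary set.

As the plane has finitely many infinite clusters, one of them contains infinitely many of these
primal half-plane clusters. Three of them, kept apart by infinite dual clusters, are joined only
through a finite boundary segment. Covering the part of that segment in the cluster by a finite
connected set gives a trifurcation (`exists_trifurcation`). Stationary trifurcations do not exist,
by the Burton–Keane comparison of volume with boundary (`ae_not_isTrifurcation`). Here the
trifurcation is produced deterministically, so no finite-energy assumption enters.

Uniqueness is also deterministic: without infinite dual clusters, two infinite primal clusters of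
the half-plane cannot be separated (`reachable_of_no_infinite_dual`). Existence obeys a zero-one law
(`infinite_cluster_zero_one`). If the primal model has no infinite half-plane cluster, uniqueness
for the dual follows from the same deterministic lemma, because the double dual is a translate;
finiteness of the number of dual clusters is not needed.

All planar topology is done by mod 2 counting: winding numbers of lattice paths (`exists_winding`)
and potentials of closed mod 2 one-forms (`boundaryIndicator_closed`). -/

namespace HalfPlanePercolation

/-! ### Connectivity inside a set of vertices -/

section Inside

variable {V : Type*} {G : SimpleGraph V}

/-- The spanning subgraph of `G` whose edges are the edges of `G` with both endpoints in `D`. -/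
def inside (G : SimpleGraph V) (D : Set V) : SimpleGraph V where
  Adj a b := G.Adj a b ∧ a ∈ D ∧ b ∈ D
  symm := ⟨fun _ _ h => ⟨h.1.symm, h.2.2, h.2.1⟩⟩
  loopless := ⟨fun a h => G.loopless.irrefl a h.1⟩

theorem reachable_induction {P : V → Prop} {u v : V} (h : G.Reachable u v) (h0 : P u)
    (hs : ∀ a b, G.Reachable u a → G.Adj a b → P a → P b) : P v := by
  have h' := (SimpleGraph.reachable_iff_reflTransGen u v).1 h
  induction h' with
  | refl => exact h0
  | tail hab hbc ih =>
    have hr := (SimpleGraph.reachable_iff_reflTransGen _ _).2 hab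
    exact hs _ _ hr hbc (ih hr)

theorem inside_le (D : Set V) : inside G D ≤ G := fun _ _ h => h.1

theorem inside_mono {D D' : Set V} (h : D ⊆ D') : inside G D ≤ inside G D' :=
  fun _ _ hab => ⟨hab.1, h hab.2.1, h hab.2.2⟩

theorem mem_of_inside_reachable {D : Set V} {u v : V} (h : (inside G D).Reachable u v)
    (hu : u ∈ D) : v ∈ D :=
  reachable_induction h hu fun _ _ _ hab _ => hab.2.2

theorem inside_reachable_of_forall_mem {D D' : Set V} {u v : V}
    (h : (inside G D).Reachable u v)
    (hD : ∀ x, (inside G D).Reachable u x → x ∈ D') : (inside G D').Reachable u v :=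
  reachable_induction h (SimpleGraph.Reachable.refl _) fun a b hua hab ih =>
    ih.trans (SimpleGraph.Adj.reachable
      ⟨hab.1, hD a hua, hD b (hua.trans (SimpleGraph.Adj.reachable hab))⟩)

/-- A path from outside `b` to `b` has an initial part that avoids `b` and then enters `b`. -/
theorem exists_adj_of_reachable {b : Set V} {w a : V} (h : G.Reachable w a) (hw : w ∉ b)
    (ha : a ∈ b) : ∃ c d, (inside G bᶜ).Reachable w c ∧ c ∉ b ∧ d ∈ b ∧ G.Adj c d := by
  by_contra! hcon
  have : a ∉ b ∧ (inside G bᶜ).Reachable w a := by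
    refine reachable_induction (P := fun a => a ∉ b ∧ (inside G bᶜ).Reachable w a) h
      ⟨hw, SimpleGraph.Reachable.refl _⟩ fun x y _ hxy ih => ?_
    have hy : y ∉ b := fun hy => hcon x y ih.2 ih.1 hy hxy
    exact ⟨hy, ih.2.trans (SimpleGraph.Adj.reachable ⟨hxy, ih.1, hy⟩)⟩
  exact this.1 ha

/-- `b` is nonempty and connected, using only edges between its own vertices. -/
def ConnectedSet (G : SimpleGraph V) (b : Finset V) : Prop :=
  b.Nonempty ∧ ∀ a ∈ b, ∀ c ∈ b, (inside G b).Reachable a c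

/-- If the component of `p` in the complement of `b` does not meet `b'`, and `b` is a connected
set disjoint from `b'`, then all vertices of `b` are connected to `p` off `b'`. -/
theorem reachable_off {b b' : Finset V} (hb : ConnectedSet G b) (hd : Disjoint b b') {p e : V}
    (he : e ∈ b) (hpb : p ∉ b) (hpe : G.Reachable p e)
    (hp : ∀ x, (inside G (b : Set V)ᶜ).Reachable p x → x ∉ b') :
    (inside G (b' : Set V)ᶜ).Reachable p e := by
  obtain ⟨c, d, hpc, hcb, hdb, hcd⟩ := exists_adj_of_reachable (b := (b : Set V)) hpe
    (by simpa using hpb) (by simpa using he)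
  have h1 : (inside G (b' : Set V)ᶜ).Reachable p c :=
    inside_reachable_of_forall_mem hpc fun x hx => by simpa using hp x hx
  have hdb' : ∀ x ∈ b, x ∉ b' := fun x hx hx' => Finset.disjoint_left.1 hd hx hx'
  have h2 : (inside G (b' : Set V)ᶜ).Reachable d e :=
    (hb.2 d hdb e he).mono (inside_mono fun x hx => by simpa using hdb' x hx)
  refine h1.trans (.trans (SimpleGraph.Adj.reachable ⟨hcd, ?_, ?_⟩) h2)
  · simpa using hp c hpc
  · simpa using hdb' d hdb

/-- `b` separates three of the vertices in `P`, all of them in the cluster of `b`. -/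
def SeparatesThree (G : SimpleGraph V) (b : Finset V) (P : Set V) : Prop :=
  ∃ p ∈ P, ∃ q ∈ P, ∃ r ∈ P,
    (∀ e ∈ b, G.Reachable p e ∧ G.Reachable q e ∧ G.Reachable r e) ∧
    ¬ (inside G (b : Set V)ᶜ).Reachable p q ∧ ¬ (inside G (b : Set V)ᶜ).Reachable q r ∧
    ¬ (inside G (b : Set V)ᶜ).Reachable p r

open Classical in
/-- The number of members of `𝓑` that meet the component of `w` in the complement of `b`. -/
noncomputable def hitCount (G : SimpleGraph V) (𝓑 : Finset (Finset V)) (b : Finset V) (w : V) : ℕ :=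
  (𝓑.filter fun b' => ∃ z ∈ b', (inside G (b : Set V)ᶜ).Reachable w z).card

/-- If `b` maximizes the number of hits in one of its components, then the other components
meet no further member of the family. -/
theorem not_mem_of_hitCount_max {𝓑 : Finset (Finset V)}
    (hdis : ∀ b ∈ 𝓑, ∀ b' ∈ 𝓑, b ≠ b' → Disjoint b b') (hconn : ∀ b ∈ 𝓑, ConnectedSet G b)
    {b : Finset V} {w : V} (hb : b ∈ 𝓑) (hw : w ∉ b) (hwb : ∀ e ∈ b, G.Reachable w e)
    (hmax : ∀ b' ∈ 𝓑, ∀ w', w' ∉ b' → (∀ e ∈ b', G.Reachable w' e) →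
      hitCount G 𝓑 b' w' ≤ hitCount G 𝓑 b w)
    {b' : Finset V} (hb' : b' ∈ 𝓑) (hne : b' ≠ b) {p z : V}
    (hpe : ∀ e ∈ b, G.Reachable p e)
    (hpw : ¬ (inside G (b : Set V)ᶜ).Reachable p w)
    (hpz : (inside G (b : Set V)ᶜ).Reachable p z) : z ∉ b' := by
  classical
  intro hz
  have hd : Disjoint b b' := hdis b hb b' hb' hne.symm
  have hbb : (b' : Set V) ⊆ (b : Set V)ᶜ := fun x hx hx' =>
    Finset.disjoint_left.1 hd (by simpa using hx') (by simpa using hx)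
  -- `b'` is connected and avoids `b`, so it lies wholly in the component of `p`, which is not that
  -- of `w`.
  have hwU : ∀ x, (inside G (b : Set V)ᶜ).Reachable w x → x ∉ b' := by
    intro x hx hxb
    exact hpw (hpz.trans ((((hconn b' hb').2 z hz x hxb).mono (inside_mono hbb)).trans hx.symm))
  obtain ⟨e, he⟩ := (hconn b hb).1
  have heb' : e ∉ b' := Finset.disjoint_left.1 hd he
  -- Off `b'`, the component of `w` is joined to `b`. So the component of `e` off `b'` hits all that
  -- `w` hit and also `b` itself, against maximality.
  have hwe : (inside G (b' : Set V)ᶜ).Reachable w e :=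
    reachable_off (hconn b hb) hd he hw (hwb e he) hwU
  have hle := hmax b' hb' e heb' fun f hf =>
    (hpe e he).symm.trans ((hpz.mono (inside_le _)).trans
      (((hconn b' hb').2 z hz f hf).mono (inside_le _)))
  refine absurd hle (not_le.2 (Finset.card_lt_card ?_))
  refine Finset.ssubset_iff_of_subset ?_ |>.2 ⟨b, ?_, ?_⟩
  · intro b'' hb''
    rw [Finset.mem_filter] at hb'' ⊢
    obtain ⟨h1, y, hy, hwy⟩ := hb''
    refine ⟨h1, y, hy, hwe.symm.trans ?_⟩
    exact inside_reachable_of_forall_mem hwy fun x hx => by simpa using hwU x hx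
  · exact Finset.mem_filter.2 ⟨hb, e, he, .refl _⟩
  · rw [Finset.mem_filter]
    rintro ⟨-, y, hy, hwy⟩
    exact mem_of_inside_reachable hwy (by simpa using hw) (by simpa using hy)

/-- A disjoint family of connected finite sets, each separating three of the vertices of `P`,
has at most as many members as `P`. -/
theorem card_le_of_separatesThree (G : SimpleGraph V) :
    ∀ (n : ℕ) (𝓑 : Finset (Finset V)) (P : Finset V), 𝓑.card = n →
    (∀ b ∈ 𝓑, ∀ b' ∈ 𝓑, b ≠ b' → Disjoint b b') → (∀ b ∈ 𝓑, ConnectedSet G b) →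
    (∀ b ∈ 𝓑, Disjoint b P) → (∀ b ∈ 𝓑, SeparatesThree G b P) → n ≤ P.card := by
  classical
  intro n
  induction n with
  | zero => intros; exact Nat.zero_le _
  | succ n ih =>
    intro 𝓑 P hcard hdis hconn hP hsep
    have hvalid : ∃ k, ∃ b ∈ 𝓑, ∃ w, w ∉ b ∧ (∀ e ∈ b, G.Reachable w e) ∧
        hitCount G 𝓑 b w = k := by
      obtain ⟨b, hb⟩ : 𝓑.Nonempty := Finset.card_pos.1 (by omega)
      obtain ⟨p, hp, q, hq, r, hr, hre, -⟩ := hsep b hb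
      exact ⟨_, b, hb, p, fun h => Finset.disjoint_left.1 (hP b hb) h hp,
        fun e he => (hre e he).1, rfl⟩
    have hbound : ∀ k, (∃ b ∈ 𝓑, ∃ w, w ∉ b ∧ (∀ e ∈ b, G.Reachable w e) ∧
        hitCount G 𝓑 b w = k) → k ≤ 𝓑.card := by
      rintro k ⟨b, -, w, -, -, rfl⟩
      exact Finset.card_filter_le _ _
    -- A pair with the most hits makes `b` a leaf: every component other than that of `w` meets no
    -- other member of the family.
    obtain ⟨b, hb, w, hw, hwb, hk⟩ := Nat.findGreatest_spec (P := fun k => ∃ b ∈ 𝓑, ∃ w,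
      w ∉ b ∧ (∀ e ∈ b, G.Reachable w e) ∧ hitCount G 𝓑 b w = k)
      (hbound _ hvalid.choose_spec) hvalid.choose_spec
    have hmax : ∀ b' ∈ 𝓑, ∀ w', w' ∉ b' → (∀ e ∈ b', G.Reachable w' e) →
        hitCount G 𝓑 b' w' ≤ hitCount G 𝓑 b w := by
      intro b' hb' w' h1 h2
      rw [hk]
      exact Nat.le_findGreatest (hbound _ ⟨b', hb', w', h1, h2, rfl⟩) ⟨b', hb', w', h1, h2, rfl⟩
    -- two of the three separated vertices are not in the component of `w`
    obtain ⟨p, hp, q, hq, hpe, hqe, hpq, hpw, hqw⟩ : ∃ p ∈ P, ∃ q ∈ P,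
        (∀ e ∈ b, G.Reachable p e) ∧ (∀ e ∈ b, G.Reachable q e) ∧
        ¬ (inside G (b : Set V)ᶜ).Reachable p q ∧ ¬ (inside G (b : Set V)ᶜ).Reachable p w ∧
        ¬ (inside G (b : Set V)ᶜ).Reachable q w := by
      obtain ⟨p, hp, q, hq, r, hr, hre, h1, h2, h3⟩ := hsep b hb
      by_cases hpw : (inside G (b : Set V)ᶜ).Reachable p w
      · exact ⟨q, hq, r, hr, fun e he => (hre e he).2.1, fun e he => (hre e he).2.2, h2,
          fun h => h1 (hpw.trans h.symm), fun h => h3 (hpw.trans h.symm)⟩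
      · by_cases hqw : (inside G (b : Set V)ᶜ).Reachable q w
        · exact ⟨p, hp, r, hr, fun e he => (hre e he).1, fun e he => (hre e he).2.2, h3, hpw,
            fun h => h2 (hqw.trans h.symm)⟩
        · exact ⟨p, hp, q, hq, fun e he => (hre e he).1, fun e he => (hre e he).2.1, h1, hpw, hqw⟩
    have hpb : p ∉ b := fun h => Finset.disjoint_left.1 (hP b hb) h hp
    have hqb : q ∉ b := fun h => Finset.disjoint_left.1 (hP b hb) h hq
    have hne : q ≠ p := by rintro rfl; exact hpq (.refl _)
    obtain ⟨e, he⟩ := (hconn b hb).1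
    have hpq' : ∀ b' ∈ 𝓑, b' ≠ b → (inside G (b' : Set V)ᶜ).Reachable p q := by
      intro b' hb' hne
      have hd : Disjoint b b' := hdis b hb b' hb' hne.symm
      exact (reachable_off (hconn b hb) hd he hpb (hpe e he) fun x hx =>
          not_mem_of_hitCount_max hdis hconn hb hw hwb hmax hb' hne hpe hpw hx).trans
        (reachable_off (hconn b hb) hd he hqb (hqe e he) fun x hx =>
          not_mem_of_hitCount_max hdis hconn hb hw hwb hmax hb' hne hqe hqw hx).symm
    have hpqG : G.Reachable p q := (hpe e he).trans (hqe e he).symm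
    -- Delete the leaf `b` together with `p`. For every other member, `q` can replace `p`, since the
    -- two remain connected off it.
    have key := ih (𝓑.erase b) (P.erase p) (by rw [Finset.card_erase_of_mem hb]; omega)
      (fun b1 h1 b2 h2 => hdis b1 (Finset.mem_of_mem_erase h1) b2 (Finset.mem_of_mem_erase h2))
      (fun b1 h1 => hconn b1 (Finset.mem_of_mem_erase h1))
      (fun b1 h1 => (hP b1 (Finset.mem_of_mem_erase h1)).mono_right (Finset.erase_subset _ _))
      ?_
    · rw [Finset.card_erase_of_mem hp] at key
      have : 0 < P.card := Finset.card_pos.2 ⟨p, hp⟩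
      omega
    · intro b' hb'
      have hb'𝓑 := Finset.mem_of_mem_erase hb'
      have hr := hpq' b' hb'𝓑 (Finset.ne_of_mem_erase hb')
      have hsub : ∀ x ∈ P, ∃ y ∈ P.erase p, (inside G (b' : Set V)ᶜ).Reachable x y ∧
          G.Reachable x y := by
        intro x hx
        by_cases hxp : x = p
        · subst hxp
          exact ⟨q, Finset.mem_erase.2 ⟨hne, hq⟩, hr, hpqG⟩
        · exact ⟨x, Finset.mem_erase.2 ⟨hxp, hx⟩, .refl _, .refl _⟩
      obtain ⟨x, hx, y, hy, z, hz, hre, h1, h2, h3⟩ := hsep b' hb'𝓑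
      obtain ⟨x', hx', hxx, hxG⟩ := hsub x hx
      obtain ⟨y', hy', hyy, hyG⟩ := hsub y hy
      obtain ⟨z', hz', hzz, hzG⟩ := hsub z hz
      exact ⟨x', hx', y', hy', z', hz', fun e he => ⟨hxG.symm.trans (hre e he).1,
        hyG.symm.trans (hre e he).2.1, hzG.symm.trans (hre e he).2.2⟩,
        fun h => h1 (hxx.trans (h.trans hyy.symm)), fun h => h2 (hyy.trans (h.trans hzz.symm)),
        fun h => h3 (hxx.trans (h.trans hzz.symm))⟩

end Inside

/-! ### Planar duality for pairs of subgraphs of the square lattice -/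

section Planar

/-- The half-plane above height `y`. -/
def halfPlane (y : ℤ) : Set (ℤ × ℤ) := {v | y ≤ v.2}

/-- The vertex `u` has an infinite cluster in the subgraph of `G` induced by `D`. -/
def InfiniteIn {V : Type*} (G : SimpleGraph V) (D : Set V) (u : V) : Prop :=
  u ∈ D ∧ {v | (inside G D).Reachable u v}.Infinite

/-- `G` and `G'` are subgraphs of the square lattice, and an edge of the (dual) lattice belongs
to `G'` if and only if the edge that it crosses does not belong to `G`. -/
structure PlanarDual (G G' : SimpleGraph (ℤ × ℤ)) : Prop where
  le : G ≤ squareLattice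
  le' : G' ≤ squareLattice
  right : ∀ x y, G'.Adj (x, y) (x + 1, y) ↔ ¬ G.Adj (x + 1, y) (x + 1, y + 1)
  up : ∀ x y, G'.Adj (x, y) (x, y + 1) ↔ ¬ G.Adj (x, y + 1) (x + 1, y + 1)

theorem squareLattice_cases {p q : ℤ × ℤ} (h : squareLattice.Adj p q) :
    (q = (p.1 + 1, p.2)) ∨ (q = (p.1, p.2 + 1)) ∨ (p = (q.1 + 1, q.2)) ∨ (p = (q.1, q.2 + 1)) := by
  simpa [squareLattice_adj, Prod.ext_iff] using h

/-- Contribution of the edge between `u` and `v` to the number of horizontal edges of a path that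
lie below the plaquette `(x, y)`. -/
def crossCount (x y : ℤ) (u v : ℤ × ℤ) : ZMod 2 :=
  if u.2 = v.2 ∧ min u.1 v.1 = x ∧ u.2 ≤ y then 1 else 0

/-- Indicator that `u` lies on the right side of the column `x`, at height at most `y`. -/
def below (x y : ℤ) (u : ℤ × ℤ) : ZMod 2 := if u.1 = x + 1 ∧ u.2 ≤ y then 1 else 0

/-- Raising the plaquette lengthens its downward ray by one crossing only, namely the edge assumed
absent. -/
theorem crossCount_up {Γ : SimpleGraph (ℤ × ℤ)} (hΓ : Γ ≤ squareLattice) {u v : ℤ × ℤ}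
    (huv : Γ.Adj u v) {x y : ℤ} (h : ¬ Γ.Adj (x, y + 1) (x + 1, y + 1)) :
    crossCount x (y + 1) u v = crossCount x y u v := by
  have h' : ¬ Γ.Adj (x + 1, y + 1) (x, y + 1) := fun h1 => h h1.symm
  obtain ⟨a, b⟩ := u
  obtain ⟨c, d⟩ := v
  have key : ¬ (b = d ∧ min a c = x ∧ b = y + 1) := by
    rintro ⟨rfl, hm, rfl⟩
    rcases squareLattice_cases (hΓ huv) with h1 | h1 | h1 | h1 <;>
      simp only [Prod.mk.injEq] at h1 <;> obtain ⟨h1, h2⟩ := h1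
    · obtain rfl : a = x := by omega
      subst h1
      exact h huv
    · omega
    · obtain rfl : c = x := by omega
      subst h1
      exact h' huv
    · omega
  unfold crossCount
  refine if_congr ?_ rfl rfl
  simp only
  omega

/-- An edge of `Γ` with one endpoint in column `x + 1` at height at most `y` is either counted on
exactly one side of that column or is vertical. A vertical edge of the column stays inside this
lower part or outside it, because the only edge leaving it is absent. Summed along a path, the
`below` terms of interior vertices cancel. -/
theorem crossCount_right {Γ : SimpleGraph (ℤ × ℤ)} (hΓ : Γ ≤ squareLattice) {u v : ℤ × ℤ}
    (huv : Γ.Adj u v) {x y : ℤ} (h : ¬ Γ.Adj (x + 1, y) (x + 1, y + 1)) :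
    crossCount (x + 1) y u v = crossCount x y u v + below x y u + below x y v := by
  have h' : ¬ Γ.Adj (x + 1, y + 1) (x + 1, y) := fun h1 => h h1.symm
  obtain ⟨a, b⟩ := u
  obtain ⟨c, d⟩ := v
  have h11 : (1 : ZMod 2) + 1 = 0 := by decide
  have key : ¬ (a = x + 1 ∧ c = x + 1 ∧ min b d = y) := by
    rintro ⟨rfl, rfl, hm⟩
    rcases squareLattice_cases (hΓ huv) with h1 | h1 | h1 | h1 <;>
      simp only [Prod.mk.injEq] at h1 <;> obtain ⟨h1, h2⟩ := h1
    · omega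
    · obtain rfl : b = y := by omega
      subst h2
      exact h huv
    · omega
    · obtain rfl : d = y := by omega
      subst h2
      exact h' huv
  unfold crossCount below
  simp only
  rcases squareLattice_cases (hΓ huv) with h1 | h1 | h1 | h1 <;>
    simp only [Prod.mk.injEq] at h1 <;> obtain ⟨rfl, rfl⟩ := h1 <;>
    split_ifs <;> first | omega | simp [h11]

/-- The mod 2 winding numbers of a path from `u` to `v`. -/
theorem exists_winding {Γ : SimpleGraph (ℤ × ℤ)} (hΓ : Γ ≤ squareLattice)
    (hΓ0 : Γ ≤ inside Γ (halfPlane 0)) {d : ℤ}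
    (hd : ¬ Γ.Adj (d, 0) (d + 1, 0)) {u v : ℤ × ℤ} (h : Γ.Reachable u v) :
    ∃ (N : ℤ → ℤ → ZMod 2) (M : ℤ),
      (∀ x y, ¬ Γ.Adj (x, y + 1) (x + 1, y + 1) → N x (y + 1) = N x y) ∧
      (∀ x y, ¬ Γ.Adj (x + 1, y) (x + 1, y + 1) →
        N (x + 1) y = N x y + below x y u + below x y v) ∧
      (∀ x y, M ≤ |x| → N x y = 0) ∧
      (∀ x y, M ≤ y → N x y = (if u.1 ≤ x then 1 else 0) + (if v.1 ≤ x then 1 else 0)) ∧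
      N d 0 = 0 := by
  have h2 : (2 : ZMod 2) = 0 := by decide
  refine reachable_induction (P := fun v => ∃ (N : ℤ → ℤ → ZMod 2) (M : ℤ),
      (∀ x y, ¬ Γ.Adj (x, y + 1) (x + 1, y + 1) → N x (y + 1) = N x y) ∧
      (∀ x y, ¬ Γ.Adj (x + 1, y) (x + 1, y + 1) →
        N (x + 1) y = N x y + below x y u + below x y v) ∧
      (∀ x y, M ≤ |x| → N x y = 0) ∧
      (∀ x y, M ≤ y → N x y = (if u.1 ≤ x then 1 else 0) + (if v.1 ≤ x then 1 else 0)) ∧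
      N d 0 = 0) h ?_ ?_
  · refine ⟨0, 0, fun _ _ _ => rfl, fun x y _ => ?_, fun _ _ _ => rfl, fun x y _ => ?_, rfl⟩
    · simp only [Pi.zero_apply]
      linear_combination (-below x y u) * h2
    · simp only [Pi.zero_apply]
      split_ifs <;> decide
  · rintro a b - hab ⟨N, M, hV, hH, hx, hy, h0⟩
    have hsq := squareLattice_cases (hΓ hab)
    -- The margin 2 clears both endpoints of the new edge, as their coordinates differ by at most 1.
    refine ⟨fun x y => N x y + crossCount x y a b, max M (max (|a.1| + 2) (|a.2| + 2)),
      fun x y hxy => ?_, fun x y hxy => ?_, fun x y hM => ?_, fun x y hM => ?_, ?_⟩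
    · simp only [hV x y hxy, crossCount_up hΓ hab hxy]
    · simp only [hH x y hxy, crossCount_right hΓ hab hxy]
      linear_combination (below x y a) * h2
    · simp only [hx x y (by omega), zero_add, crossCount]
      rw [if_neg]
      have hx' := abs_cases x
      have ha' := abs_cases a.1
      rcases hsq with h1 | h1 | h1 | h1 <;> rw [Prod.ext_iff] at h1 <;> simp only at h1 <;>
        omega
    · simp only [hy x y (by omega), crossCount]
      have ha' := le_abs_self a.2
      rcases hsq with h1 | h1 | h1 | h1 <;> rw [Prod.ext_iff] at h1 <;> simp only at h1 <;>
        split_ifs <;> first | omega | decide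
    · simp only [h0, zero_add, crossCount]
      rw [if_neg]
      rintro ⟨e1, e2, e3⟩
      have hH := hΓ0 hab
      have e4 : 0 ≤ a.2 := hH.2.1
      have e5 : a.2 = 0 := by omega
      obtain ⟨a1, a2⟩ := a
      obtain ⟨b1, b2⟩ := b
      simp only at *
      subst e1 e5
      rcases hsq with h1 | h1 | h1 | h1 <;> simp only [Prod.mk.injEq] at h1 <;>
        obtain ⟨h1, h3⟩ := h1
      · obtain rfl : a1 = d := by omega
        subst h1
        exact hd hab
      · omega
      · obtain rfl : b1 = d := by omega
        subst h1
        exact hd hab.symm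
      · omega

/-- The open edges in the upper half-plane together with all the boundary edges except the one
below the plaquette `(d, 0)`. -/
def slitGraph (G : SimpleGraph (ℤ × ℤ)) (d : ℤ) : SimpleGraph (ℤ × ℤ) where
  Adj a b := squareLattice.Adj a b ∧ 0 ≤ a.2 ∧ 0 ≤ b.2 ∧ (G.Adj a b ∨ a.2 = 0 ∧ b.2 = 0) ∧
    ¬ (a = (d, 0) ∧ b = (d + 1, 0)) ∧ ¬ (b = (d, 0) ∧ a = (d + 1, 0))
  symm := ⟨fun _ _ h => ⟨h.1.symm, h.2.2.1, h.2.1, h.2.2.2.1.imp (fun h => h.symm) And.symm,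
    h.2.2.2.2.2, h.2.2.2.2.1⟩⟩
  loopless := ⟨fun a h => squareLattice.loopless.irrefl a h.1⟩

/-- Such a path and the missing boundary edge would form a loop around the plaquette `(d, 0)`. Dual
open steps in the half-plane do not cross the loop, so the winding number stays 1 along the dual
cluster, yet it vanishes far away; the cluster would be finite. -/
theorem slitGraph_not_reachable {G G' : SimpleGraph (ℤ × ℤ)} (hG : PlanarDual G G') {d : ℤ}
    (hd : InfiniteIn G' (halfPlane 0) (d, 0)) :
    ¬ (slitGraph G d).Reachable (d, 0) (d + 1, 0) := by
  intro hr
  have h2 : (2 : ZMod 2) = 0 := by decide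
  obtain ⟨N, M, hV, hH, hx, hy, h0⟩ := exists_winding (Γ := slitGraph G d) (d := d)
    (fun _ _ h => h.1) (fun _ _ h => ⟨h, h.2.1, h.2.2.1⟩)
    (fun h => h.2.2.2.2.1 ⟨rfl, rfl⟩) hr
  -- The indicator is the contribution of the missing edge. It closes the loop and cancels the
  -- endpoint terms `below`.
  set N' : ℤ → ℤ → ZMod 2 := fun x y => N x y + if x = d ∧ 0 ≤ y then 1 else 0 with hN'
  have hV' : ∀ x y, 0 ≤ y → G'.Adj (x, y) (x, y + 1) → N' x (y + 1) = N' x y := by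
    intro x y hy hadj
    have h1 : ¬ (slitGraph G d).Adj (x, y + 1) (x + 1, y + 1) := by
      rintro ⟨-, -, -, h1 | h1, -⟩
      · exact (hG.up x y).1 hadj h1
      · simp only at h1
        omega
    simp only [hN', hV x y h1]
    congr 1
    exact if_congr (by omega) rfl rfl
  have hH' : ∀ x y, 0 ≤ y → G'.Adj (x, y) (x + 1, y) → N' (x + 1) y = N' x y := by
    intro x y hy hadj
    have h1 : ¬ (slitGraph G d).Adj (x + 1, y) (x + 1, y + 1) := by
      rintro ⟨-, -, -, h1 | h1, -⟩
      · exact (hG.right x y).1 hadj h1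
      · simp only at h1
        omega
    simp only [hN', hH x y h1, below]
    split_ifs <;> first | omega | (linear_combination h2) | (linear_combination (0 : ZMod 2) * h2)
  have hconst : ∀ p, (inside G' (halfPlane 0)).Reachable (d, 0) p → 0 ≤ p.2 ∧ N' p.1 p.2 = 1 := by
    intro p hp
    refine reachable_induction (P := fun p => 0 ≤ p.2 ∧ N' p.1 p.2 = 1) hp
      ⟨le_rfl, by simp [hN', h0]⟩ ?_
    rintro ⟨a1, a2⟩ ⟨b1, b2⟩ - ⟨hab, ha, hb⟩ ⟨-, hN⟩
    refine ⟨hb, ?_⟩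
    simp only [halfPlane, Set.mem_ofPred_eq] at ha hb hN ⊢
    rw [← hN]
    rcases squareLattice_cases (hG.le' hab) with h1 | h1 | h1 | h1 <;>
      simp only [Prod.mk.injEq] at h1 <;> obtain ⟨rfl, rfl⟩ := h1
    · exact hH' _ _ ha hab
    · exact hV' _ _ ha hab
    · exact (hH' _ _ hb hab.symm).symm
    · exact (hV' _ _ hb hab.symm).symm
  refine hd.2 (Set.Finite.subset (Set.finite_Icc
    ((-(|M| + |d| + 1), 0) : ℤ × ℤ) (|M| + |d| + 1, |M|)) fun p hp => ?_)
  obtain ⟨hp0, hp1⟩ := hconst p hp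
  have c1 : |p.1| ≤ |M| + |d| := by
    by_contra! hcon
    have h3 : N' p.1 p.2 = 0 := by
      simp only [hN']
      rw [hx _ _ (by have := le_abs_self M; have := abs_nonneg d; omega), if_neg, add_zero]
      rintro ⟨e, -⟩
      rw [e] at hcon
      have := abs_nonneg M
      omega
    rw [h3] at hp1
    exact absurd hp1 (by decide)
  have c2 : p.2 ≤ |M| := by
    by_contra! hcon
    have h3 : N' p.1 p.2 = 0 := by
      simp only [hN']
      -- Above the loop, the indicators of `d ≤ x`, `d + 1 ≤ x` and `x = d` add up to zero mod 2.
      rw [hy _ _ (by have := le_abs_self M; omega)]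
      simp only
      split_ifs <;> first | omega | decide
    rw [h3] at hp1
    exact absurd hp1 (by decide)
  rw [Set.mem_Icc, Prod.le_def, Prod.le_def]
  simp only
  have := abs_le.1 c1
  omega

/-- The part of the upper half-plane to the left of an infinite dual cluster that starts at the
plaquette `(d, 0)`. -/
theorem exists_left_set {G G' : SimpleGraph (ℤ × ℤ)} (hG : PlanarDual G G') {d : ℤ}
    (hd : InfiniteIn G' (halfPlane 0) (d, 0)) :
    ∃ L : Set (ℤ × ℤ), (∀ j, (j, (0 : ℤ)) ∈ L ↔ j ≤ d) ∧ (∀ a ∈ L, 0 ≤ a.2) ∧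
      ∀ a b, G.Adj a b → 0 ≤ a.2 → 0 ≤ b.2 → ¬ (a = (d, 0) ∧ b = (d + 1, 0)) →
        ¬ (b = (d, 0) ∧ a = (d + 1, 0)) → a ∈ L → b ∈ L := by
  have hadj : ∀ j : ℤ, j ≠ d → (slitGraph G d).Adj (j, 0) (j + 1, 0) := by
    intro j hj
    refine ⟨by simp [squareLattice_adj], le_rfl, le_rfl, .inr ⟨rfl, rfl⟩, ?_, ?_⟩ <;>
      simp only [Prod.mk.injEq] <;> omega
  have hleft : ∀ n : ℕ, (slitGraph G d).Reachable (d, 0) (d - n, 0) := by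
    intro n
    induction n with
    | zero => simp
    | succ n ih =>
      refine ih.trans (SimpleGraph.Adj.reachable ?_).symm
      have := hadj (d - (n + 1 : ℕ)) (by omega)
      convert this using 2
      push_cast
      ring
  have hright : ∀ n : ℕ, (slitGraph G d).Reachable (d + 1, 0) (d + 1 + n, 0) := by
    intro n
    induction n with
    | zero => simp
    | succ n ih =>
      refine ih.trans (SimpleGraph.Adj.reachable ?_)
      have := hadj (d + 1 + n) (by omega)
      convert this using 2
      push_cast
      ring
  -- The boundary edges were added whether open or not so that this component meets the boundary
  -- line in exactly a half-line.
  refine ⟨{a | (slitGraph G d).Reachable (d, 0) a}, fun j => ⟨fun h => ?_, fun h => ?_⟩,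
    fun a ha => ?_, fun a b hab ha hb h1 h2 haL => ?_⟩
  · by_contra! hcon
    have h3 := hright (j - d - 1).toNat
    rw [show d + 1 + ((j - d - 1).toNat : ℤ) = j by omega] at h3
    exact slitGraph_not_reachable hG hd (SimpleGraph.Reachable.trans h h3.symm)
  · have h3 := hleft (d - j).toNat
    rwa [show d - ((d - j).toNat : ℤ) = j by omega] at h3
  · exact reachable_induction (P := fun a : ℤ × ℤ => 0 ≤ a.2) ha le_rfl
      fun _ _ _ hab _ => hab.2.2.1
  · exact SimpleGraph.Reachable.trans haL
      (SimpleGraph.Adj.reachable ⟨hG.le hab, ha, hb, .inl hab, h1, h2⟩)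

end Planar

/-! ### Trifurcations from alternating primal and dual clusters -/

section Trifurcation

/-- A finite connected set `b` that cuts its cluster into at least three unbounded parts. -/
def IsTrifurcation {V : Type*} (G : SimpleGraph V) (b : Finset V) : Prop :=
  ConnectedSet G b ∧ ∀ F : Finset V, SeparatesThree G b (F : Set V)ᶜ

theorem exists_finset_of_reachable {V : Type*} {G : SimpleGraph V} {v w : V}
    (h : G.Reachable v w) :
    ∃ b : Finset V, v ∈ b ∧ w ∈ b ∧ ∀ a ∈ b, (inside G (b : Set V)).Reachable v a := by
  classical
  refine reachable_induction (P := fun w => ∃ b : Finset V, v ∈ b ∧ w ∈ b ∧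
    ∀ a ∈ b, (inside G (b : Set V)).Reachable v a) h ⟨{v}, by simp⟩ ?_
  rintro x y - hxy ⟨b, hv, hx, hb⟩
  have hmono : inside G (b : Set V) ≤ inside G ((insert y b : Finset V) : Set V) :=
    inside_mono (by simp)
  refine ⟨insert y b, by simp [hv], by simp, fun a ha => ?_⟩
  rcases Finset.mem_insert.1 ha with rfl | ha
  · exact ((hb x hx).mono hmono).trans (SimpleGraph.Adj.reachable ⟨hxy, by simp [hx], by simp⟩)
  · exact (hb a ha).mono hmono

/-- The part of a finite set in the cluster of `v` is covered by a finite connected set. -/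
theorem exists_connectedSet {V : Type*} (G : SimpleGraph V) (v : V) (F : Finset V) :
    ∃ b : Finset V, v ∈ b ∧ ConnectedSet G b ∧ ∀ w ∈ F, G.Reachable v w → w ∈ b := by
  classical
  suffices h : ∃ b : Finset V, v ∈ b ∧ (∀ a ∈ b, (inside G (b : Set V)).Reachable v a) ∧
      ∀ w ∈ F, G.Reachable v w → w ∈ b by
    obtain ⟨b, hv, hb, hF⟩ := h
    exact ⟨b, hv, ⟨⟨v, hv⟩, fun a ha c hc => (hb a ha).symm.trans (hb c hc)⟩, hF⟩
  induction F using Finset.induction_on with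
  | empty => exact ⟨{v}, by simp⟩
  | insert w F _ ih =>
    obtain ⟨b, hv, hb, hF⟩ := ih
    by_cases hw : G.Reachable v w
    · obtain ⟨b', hv', hw', hb'⟩ := exists_finset_of_reachable hw
      refine ⟨b ∪ b', by simp [hv], fun a ha => ?_, fun x hx hvx => ?_⟩
      · rcases Finset.mem_union.1 ha with ha | ha
        · exact (hb a ha).mono (inside_mono (by simp))
        · exact (hb' a ha).mono (inside_mono (by simp))
      · rcases Finset.mem_insert.1 hx with rfl | hx
        · exact Finset.mem_union_right _ hw'
        · exact Finset.mem_union_left _ (hF x hx hvx)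
    · refine ⟨b, hv, hb, fun x hx hvx => ?_⟩
      rcases Finset.mem_insert.1 hx with rfl | hx
      · exact absurd hvx hw
      · exact hF x hx hvx

/-- There is an open edge from `(x, y)` to an infinite cluster of the half-plane above it. -/
def StartsRay (G : SimpleGraph (ℤ × ℤ)) (y x : ℤ) : Prop :=
  G.Adj (x, y) (x, y + 1) ∧ InfiniteIn G (halfPlane (y + 1)) (x, y + 1)

variable {G G' : SimpleGraph (ℤ × ℤ)}

/-- Two infinite dual clusters separate the primal clusters starting between them from those
starting elsewhere. -/
theorem not_reachable_off_segment (hG : PlanarDual G G') {d d' x x' : ℤ}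
    (hd : InfiniteIn G' (halfPlane 0) (d, 0)) (hd' : InfiniteIn G' (halfPlane 0) (d', 0))
    (hxd : d < x) (hxd' : x ≤ d') (hx'd : x' ≤ d ∨ d' < x')
    (hx : G.Adj (x, 0) (x, 1)) (hx' : G.Adj (x', 0) (x', 1)) {D : Set (ℤ × ℤ)}
    (hD : ∀ j, d ≤ j → j ≤ d' + 1 → (j, (0 : ℤ)) ∉ D) {u u' : ℤ × ℤ}
    (hu : (inside G (halfPlane 1)).Reachable (x, 1) u)
    (hu' : (inside G (halfPlane 1)).Reachable (x', 1) u') : ¬ (inside G D).Reachable u u' := by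
  intro hr
  obtain ⟨L, hL0, hLp, hL⟩ := exists_left_set hG hd
  obtain ⟨L', hL'0, hL'p, hL'⟩ := exists_left_set hG hd'
  -- The strip `L' \ L` between the dual clusters can only be left through the two slit edges. Both
  -- lie in the boundary segment, which `D` avoids.
  have step : ∀ a b, G.Adj a b → 0 ≤ a.2 → 0 ≤ b.2 → (0 < a.2 ∨ 0 < b.2 ∨ a ∈ D) →
      a ∈ L' \ L → b ∈ L' \ L := by
    intro a b hab ha hb hc haS
    have key : ∀ e, d ≤ e → e ≤ d' → ¬ (a = (e, 0) ∧ b = (e + 1, 0)) ∧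
        ¬ (b = (e, 0) ∧ a = (e + 1, 0)) := by
      rintro e h1 h2
      refine ⟨?_, ?_⟩
      · rintro ⟨rfl, rfl⟩
        rcases hc with hc | hc | hc
        · simp at hc
        · simp at hc
        · exact hD e h1 (by omega) hc
      · rintro ⟨rfl, rfl⟩
        rcases hc with hc | hc | hc
        · simp at hc
        · simp at hc
        · exact hD _ (by omega) (by omega) hc
    obtain ⟨k1, k2⟩ := key d le_rfl (by omega)
    obtain ⟨k3, k4⟩ := key d' (by omega) le_rfl
    exact ⟨hL' a b hab ha hb k3 k4 haS.1, fun hbL => haS.2 (hL b a hab.symm hb ha k2 k1 hbL)⟩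
  have cluster : ∀ y v, (y, (1 : ℤ)) ∈ L' \ L →
      (inside G (halfPlane 1)).Reachable (y, 1) v → v ∈ L' \ L := by
    intro y v hy hv
    refine reachable_induction hv hy fun a b _ hab haS => ?_
    have h1 : 1 ≤ a.2 := hab.2.1
    have h2 : 1 ≤ b.2 := hab.2.2
    exact step a b hab.1 (by omega) (by omega) (.inl (by omega)) haS
  have huS : u ∈ L' \ L := by
    refine cluster x u (step _ _ hx le_rfl zero_le_one (.inr (.inl zero_lt_one)) ⟨?_, ?_⟩) hu
    · exact (hL'0 x).2 hxd'
    · rw [hL0]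
      omega
  have hu'S : u' ∈ L' \ L := by
    refine reachable_induction hr huS fun a b _ hab haS => ?_
    have ha := hL'p a haS.1
    have hb : 0 ≤ b.2 := by
      -- A step into the lower half-plane would start at a boundary vertex of the strip, and these
      -- all lie in the forbidden segment.
      by_contra! hb
      have hsq := squareLattice_cases (hG.le hab.1)
      obtain ⟨a1, a2⟩ := a
      obtain ⟨b1, b2⟩ := b
      simp only [Prod.mk.injEq] at hsq ha hb
      obtain rfl : a2 = 0 := by omega
      have h1 := haS.1
      have h2 := haS.2
      rw [hL'0] at h1
      rw [hL0] at h2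
      exact hD a1 (by omega) (by omega) hab.2.1
    exact step a b hab.1 ha hb (.inr (.inr hab.2.1)) haS
  -- Run back from `u'` along its cluster to the boundary: the root `x'` would satisfy `d < x' ≤
  -- d'`.
  have hx'S : (x', (1 : ℤ)) ∈ L' \ L := by
    refine reachable_induction hu'.symm hu'S fun a b hua hab haS => ?_
    have h1 : 1 ≤ a.2 := hab.2.1
    have h2 : 1 ≤ b.2 := hab.2.2
    exact step a b hab.1 (by omega) (by omega) (.inl (by omega)) haS
  have := step _ _ hx'.symm zero_le_one le_rfl (.inl zero_lt_one) hx'S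
  rw [Set.mem_sdiff, hL'0, hL0] at this
  omega

/-- If arbitrarily far to the right there are primal and dual infinite clusters of the upper
half-plane, but only finitely many infinite clusters in the whole plane, then there is a
trifurcation. -/
theorem exists_trifurcation (hG : PlanarDual G G')
    (hfin : {C : G.ConnectedComponent | C.supp.Infinite}.Finite)
    (hX : ∀ n : ℤ, ∃ x, n < x ∧ StartsRay G 0 x)
    (hX' : ∀ n : ℤ, ∃ d, n ≤ d ∧ InfiniteIn G' (halfPlane 0) (d, 0)) :
    ∃ b, IsTrifurcation G b := by
  classical
  -- Pigeonhole: infinitely many rays lie in finitely many infinite clusters.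
  obtain ⟨C, hC⟩ : ∃ C : G.ConnectedComponent, ∀ n : ℤ, ∃ x, n < x ∧ StartsRay G 0 x ∧
      G.connectedComponentMk (x, 1) = C := by
    choose x hx hxr using hX
    have : Finite {C : G.ConnectedComponent | C.supp.Infinite} := hfin
    let f : ℕ → {C : G.ConnectedComponent | C.supp.Infinite} := fun n =>
      ⟨G.connectedComponentMk (x n, 1), (hxr n).2.2.mono fun v hv => by
        simpa using (SimpleGraph.Reachable.mono (inside_le _) hv).symm⟩
    obtain ⟨C, hC⟩ := Finite.exists_infinite_fiber f
    refine ⟨C, fun n => ?_⟩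
    obtain ⟨m, hm, hnm⟩ := (Set.infinite_coe_iff.1 hC).exists_gt n.toNat
    exact ⟨x m, by have := hx m; omega, hxr m, congrArg Subtype.val hm⟩
  obtain ⟨x₁, -, hx₁, hC₁⟩ := hC 0
  obtain ⟨d₁, hd₁, hD₁⟩ := hX' x₁
  obtain ⟨x₂, h12, hx₂, hC₂⟩ := hC d₁
  obtain ⟨d₂, hd₂, hD₂⟩ := hX' x₂
  obtain ⟨x₃, h23, hx₃, hC₃⟩ := hC d₂
  obtain ⟨d₃, hd₃, hD₃⟩ := hX' x₃
  -- The segment ends at `d₃ + 1`, the right endpoint of the slit edge below the plaquette `(d₃,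
  -- 0)`.
  set seg : Finset (ℤ × ℤ) := (Finset.Icc d₁ (d₃ + 1)).image fun j => (j, 0) with hseg
  obtain ⟨b, hvb, hb, hbseg⟩ := exists_connectedSet G (x₁, 1) seg
  have hreach : ∀ x, G.connectedComponentMk (x, 1) = C → ∀ u,
      (inside G (halfPlane 1)).Reachable (x, 1) u → G.Reachable (x₁, 1) u := by
    intro x hx u hu
    exact (SimpleGraph.ConnectedComponent.exact (hC₁.trans hx.symm)).trans (hu.mono (inside_le _))
  refine ⟨b, hb, fun F => ?_⟩
  have hpick : ∀ x, StartsRay G 0 x → ∃ u, (inside G (halfPlane 1)).Reachable (x, 1) u ∧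
      u ∉ b ∧ u ∉ F := by
    intro x hx
    obtain ⟨u, hu, hub⟩ := hx.2.2.exists_notMem_finset (b ∪ F)
    simp only [Finset.mem_union, not_or] at hub
    exact ⟨u, hu, hub⟩
  have hsep : ∀ u u', G.Reachable (x₁, 1) u → u ∉ b → (∀ D : Set (ℤ × ℤ),
      (∀ j, d₁ ≤ j → j ≤ d₃ + 1 → (j, (0 : ℤ)) ∉ D) → ¬ (inside G D).Reachable u u') →
      ¬ (inside G (b : Set (ℤ × ℤ))ᶜ).Reachable u u' := by
    intro u u' hu hub hno hr
    -- A path off `b` in this cluster also avoids the segment, because `b` contains every vertex of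
    -- the segment in the cluster.
    refine hno (seg : Set (ℤ × ℤ))ᶜ (fun j h1 h2 => ?_) (inside_reachable_of_forall_mem hr ?_)
    · simp [hseg, h1, h2]
    · intro y hy hys
      exact mem_of_inside_reachable hy (by simpa using hub)
        (hbseg y hys (hu.trans (hy.mono (inside_le _))))
  obtain ⟨u₁, hu₁, hb₁, hF₁⟩ := hpick x₁ hx₁
  obtain ⟨u₂, hu₂, hb₂, hF₂⟩ := hpick x₂ hx₂
  obtain ⟨u₃, hu₃, hb₃, hF₃⟩ := hpick x₃ hx₃
  have hr₁ := hreach x₁ hC₁ u₁ hu₁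
  have hr₂ := hreach x₂ hC₂ u₂ hu₂
  have hr₃ := hreach x₃ hC₃ u₃ hu₃
  have hbG : ∀ e ∈ b, G.Reachable (x₁, 1) e := fun e he => (hb.2 _ hvb e he).mono (inside_le _)
  refine ⟨u₁, hF₁, u₂, hF₂, u₃, hF₃, fun e he => ⟨hr₁.symm.trans (hbG e he),
    hr₂.symm.trans (hbG e he), hr₃.symm.trans (hbG e he)⟩, fun h => ?_, ?_, fun h => ?_⟩
  · refine hsep u₂ u₁ hr₂ hb₂ (fun D hD => ?_) h.symm
    exact not_reachable_off_segment hG hD₁ hD₂ h12 hd₂ (.inl hd₁) hx₂.1 hx₁.1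
      (fun j h1 h2 => hD j h1 (by omega)) hu₂ hu₁
  · refine hsep u₂ u₃ hr₂ hb₂ (fun D hD => ?_)
    exact not_reachable_off_segment hG hD₁ hD₂ h12 hd₂ (.inr h23) hx₂.1 hx₃.1
      (fun j h1 h2 => hD j h1 (by omega)) hu₂ hu₃
  · refine hsep u₃ u₁ hr₃ hb₃ (fun D hD => ?_) h.symm
    exact not_reachable_off_segment hG hD₂ hD₃ h23 hd₃ (.inl (by omega)) hx₃.1 hx₁.1
      (fun j h1 h2 => hD j (by omega) h2) hu₃ hu₁

end Trifurcation

/-! ### Uniqueness in the half-plane in the absence of infinite dual clusters -/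

section Uniqueness

variable {G G' : SimpleGraph (ℤ × ℤ)}

/-- The bottom row and the columns form a comb that connects the box, so horizontal steps are needed
only at height 0. -/
theorem function_eq_of_steps {T : ℤ × ℤ → ZMod 2} {m : ℤ}
    (hup : ∀ x y, |x| ≤ m → 0 ≤ y → y ≤ m → T (x, y + 1) = T (x, y))
    (hright : ∀ x, |x| ≤ m → T (x + 1, 0) = T (x, 0)) (u : ℤ × ℤ) (hu : |u.1| ≤ m)
    (hu0 : 0 ≤ u.2) (hum : u.2 ≤ m) : T u = T (0, 0) := by
  have h1 : ∀ x, |x| ≤ m → ∀ n : ℕ, (n : ℤ) ≤ m → T (x, n) = T (x, 0) := by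
    intro x hx n
    induction n with
    | zero => simp
    | succ n ih =>
      intro hn
      push_cast at hn ⊢
      rw [hup x n hx (by omega) (by omega), ih (by omega)]
  have h2 : ∀ n : ℕ, (n : ℤ) ≤ m → T ((n : ℤ), 0) = T (0, 0) := by
    intro n
    induction n with
    | zero => simp
    | succ n ih =>
      intro hn
      push_cast at hn ⊢
      rw [hright n (by rw [abs_of_nonneg] <;> omega), ih (by omega)]
  have h3 : ∀ n : ℕ, (n : ℤ) ≤ m → T (-(n : ℤ), 0) = T (0, 0) := by
    intro n
    induction n with
    | zero => simp
    | succ n ih =>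
      intro hn
      rw [← ih (by push_cast at hn; omega), ← hright (-((n + 1 : ℕ) : ℤ))
        (by rw [abs_neg, abs_of_nonneg] <;> push_cast at hn ⊢ <;> omega)]
      congr 2
      push_cast
      ring
  obtain ⟨x, y⟩ := u
  simp only at hu hu0 hum
  have h4 := h1 x hu y.toNat (by omega)
  rw [Int.toNat_of_nonneg hu0] at h4
  rw [h4]
  rcases le_total 0 x with hx | hx
  · have := h2 x.toNat (by have := abs_le.1 hu; omega)
    rwa [Int.toNat_of_nonneg hx] at this
  · have := h3 (-x).toNat (by have := abs_le.1 hu; omega)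
    rwa [Int.toNat_of_nonneg (by omega), neg_neg] at this

open Classical in
/-- Indicator of a boundary edge of `C` whose adjacent plaquette `p` is in `K`. -/
noncomputable def boundaryIndicator (C K : Set (ℤ × ℤ)) (p a b : ℤ × ℤ) : ZMod 2 :=
  if p ∈ K then (if a ∈ C then 1 else 0) + (if b ∈ C then 1 else 0) else 0

theorem boundaryIndicator_congr {C K : Set (ℤ × ℤ)} {p q : ℤ × ℤ} (h : p ∈ K ↔ q ∈ K)
    (a b : ℤ × ℤ) : boundaryIndicator C K p a b = boundaryIndicator C K q a b := by
  classical
  exact if_congr h rfl rfl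

theorem boundaryIndicator_eq_zero {C : Set (ℤ × ℤ)} {a b : ℤ × ℤ} (h : a ∈ C ↔ b ∈ C)
    (K : Set (ℤ × ℤ)) (p : ℤ × ℤ) : boundaryIndicator C K p a b = 0 := by
  have h11 : (1 : ZMod 2) + 1 = 0 := by decide
  by_cases ha : a ∈ C
  · simp [boundaryIndicator, ha, h.1 ha, h11]
  · simp [boundaryIndicator, ha, mt h.2 ha]

/-- The boundary of `C` is a coboundary mod 2, and restricting it to the dual clusters in `K` keeps
it closed. At each side of a plaquette, either the dual edge is open and `K` contains both adjacent
plaquettes or neither, or the primal edge is open and contributes zero. -/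
theorem boundaryIndicator_closed (hG : PlanarDual G G') {C K : Set (ℤ × ℤ)}
    (hC : ∀ a b, G.Adj a b → 0 ≤ a.2 → 0 ≤ b.2 → (a ∈ C ↔ b ∈ C))
    (hK : ∀ a b, G'.Adj a b → 0 ≤ a.2 → 0 ≤ b.2 → (a ∈ K ↔ b ∈ K)) {x y : ℤ} (hy : 0 ≤ y) :
    boundaryIndicator C K (x, y) (x, y) (x + 1, y) +
      boundaryIndicator C K (x + 1, y) (x + 1, y) (x + 1, y + 1) =
    boundaryIndicator C K (x, y) (x, y) (x, y + 1) +
      boundaryIndicator C K (x, y + 1) (x, y + 1) (x + 1, y + 1) := by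
  have e1 : boundaryIndicator C K (x + 1, y) (x + 1, y) (x + 1, y + 1) =
      boundaryIndicator C K (x, y) (x + 1, y) (x + 1, y + 1) := by
    by_cases hadj : G'.Adj (x, y) (x + 1, y)
    · exact (boundaryIndicator_congr (hK _ _ hadj hy hy) _ _).symm
    · rw [hG.right, not_not] at hadj
      have := hC _ _ hadj hy (show (0 : ℤ) ≤ y + 1 by omega)
      rw [boundaryIndicator_eq_zero this, boundaryIndicator_eq_zero this]
  have e2 : boundaryIndicator C K (x, y + 1) (x, y + 1) (x + 1, y + 1) =
      boundaryIndicator C K (x, y) (x, y + 1) (x + 1, y + 1) := by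
    have hy' : (0 : ℤ) ≤ y + 1 := by omega
    by_cases hadj : G'.Adj (x, y) (x, y + 1)
    · exact (boundaryIndicator_congr (hK _ _ hadj hy hy') _ _).symm
    · rw [hG.up, not_not] at hadj
      have := hC _ _ hadj hy' hy'
      rw [boundaryIndicator_eq_zero this, boundaryIndicator_eq_zero this]
  rw [e1, e2]
  unfold boundaryIndicator
  split_ifs <;> decide

/-- In the upper half-plane there is at most one infinite cluster if there is no infinite dual
cluster. -/
theorem reachable_of_no_infinite_dual (hG : PlanarDual G G')
    (hdual : ∀ p, ¬ InfiniteIn G' (halfPlane 0) p) {u₁ u₂ : ℤ × ℤ}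
    (h₁ : InfiniteIn G (halfPlane 0) u₁) (h₂ : InfiniteIn G (halfPlane 0) u₂) :
    (inside G (halfPlane 0)).Reachable u₁ u₂ := by
  classical
  have h2 : (2 : ZMod 2) = 0 := by decide
  set C : Set (ℤ × ℤ) := {v | (inside G (halfPlane 0)).Reachable u₁ v} with hCdef
  have hC : ∀ a b, G.Adj a b → 0 ≤ a.2 → 0 ≤ b.2 → (a ∈ C ↔ b ∈ C) := by
    intro a b hab ha hb
    have hr : (inside G (halfPlane 0)).Reachable a b := SimpleGraph.Adj.reachable ⟨hab, ha, hb⟩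
    exact ⟨fun h => SimpleGraph.Reachable.trans h hr, fun h => SimpleGraph.Reachable.trans h hr.symm⟩
  set m : ℤ := |u₁.1| + |u₁.2| + |u₂.1| + |u₂.2| with hm
  set box : Set (ℤ × ℤ) := Set.Icc (-m, 0) (m, m) with hbox
  have hboxfin : box.Finite := Set.finite_Icc _ _
  -- `K` is the union of the dual clusters that meet a box around `u₁` and `u₂`. It is finite
  -- because no dual cluster is infinite.
  set K : Set (ℤ × ℤ) := ⋃ q ∈ box, {p | (inside G' (halfPlane 0)).Reachable q p} with hKdef
  have hKfin : K.Finite := by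
    refine hboxfin.biUnion fun q hq => ?_
    by_contra hinf
    exact hdual q ⟨(Prod.le_def.1 hq.1).2, hinf⟩
  have hboxK : box ⊆ K := fun q hq => Set.mem_biUnion hq (SimpleGraph.Reachable.refl _)
  have hK : ∀ a b, G'.Adj a b → 0 ≤ a.2 → 0 ≤ b.2 → (a ∈ K ↔ b ∈ K) := by
    intro a b hab ha hb
    have hr : (inside G' (halfPlane 0)).Reachable a b := SimpleGraph.Adj.reachable ⟨hab, ha, hb⟩
    rw [hKdef, Set.mem_iUnion₂, Set.mem_iUnion₂]
    exact ⟨fun ⟨q, hq, h⟩ => ⟨q, hq, SimpleGraph.Reachable.trans h hr⟩,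
      fun ⟨q, hq, h⟩ => ⟨q, hq, SimpleGraph.Reachable.trans h hr.symm⟩⟩
  obtain ⟨M, hM⟩ : ∃ M : ℕ, ∀ p ∈ K, |p.1| < M ∧ p.2 < M := by
    refine ⟨∑ p ∈ hKfin.toFinset, (p.1.natAbs + p.2.natAbs) + 1, fun p hp => ?_⟩
    have := Finset.single_le_sum (f := fun p : ℤ × ℤ => p.1.natAbs + p.2.natAbs)
      (fun _ _ => Nat.zero_le _) (hKfin.mem_toFinset.2 hp)
    push_cast
    have h3 : ((p.1.natAbs + p.2.natAbs : ℕ) : ℤ) ≤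
      ((∑ p ∈ hKfin.toFinset, (p.1.natAbs + p.2.natAbs) : ℕ) : ℤ) := by exact_mod_cast this
    push_cast at h3
    have := le_abs_self p.2
    have := abs_nonneg p.1
    have := abs_nonneg p.2
    omega
  -- the potential of the boundary edges of `C` near the box
  set v : ℤ → ℤ → ZMod 2 := fun x y => boundaryIndicator C K (x, y) (x, y) (x, y + 1) with hv
  set h : ℤ → ℤ → ZMod 2 := fun x y => boundaryIndicator C K (x, y) (x, y) (x + 1, y) with hh
  -- `S` integrates the closed one-form downwards from height `M`, above which it vanishes.
  set S : ℤ × ℤ → ZMod 2 := fun p => ∑ j ∈ Finset.Ico p.2 M, v p.1 j with hS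
  have hout : ∀ x y, (x, y) ∉ K → v x y = 0 ∧ h x y = 0 := by
    intro x y hxy
    simp [hv, hh, boundaryIndicator, hxy]
  have hSup : ∀ x y, S (x, y + 1) = S (x, y) + v x y := by
    intro x y
    simp only [hS]
    by_cases hy : y < M
    · rw [← Finset.sum_Ioo_add_eq_sum_Ico (f := fun j => v x j) hy]
      have : Finset.Ico (y + 1) (M : ℤ) = Finset.Ioo y M := by
        ext j
        simp only [Finset.mem_Ico, Finset.mem_Ioo]
        omega
      rw [this]
      linear_combination (-v x y) * h2
    · rw [Finset.Ico_eq_empty (by omega), Finset.Ico_eq_empty (by omega),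
        (hout x y fun hp => hy (hM _ hp).2).1]
      simp
  -- Descend row by row from height `M`; closedness on one row of plaquettes carries the identity to
  -- the next row.
  have hSright : ∀ x, ∀ n : ℕ, (n : ℤ) ≤ M →
      S (x + 1, M - n) = S (x, M - n) + h x (M - n) := by
    intro x n
    induction n with
    | zero =>
      intro _
      have : (x, (M : ℤ)) ∉ K := fun hp => lt_irrefl _ (hM _ hp).2
      simp [hS, (hout x M this).2]
    | succ n ih =>
      intro hn
      push_cast at hn ⊢
      have hcl := boundaryIndicator_closed hG hC hK (x := x) (y := M - (n + 1)) (by omega)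
      have s1 := hSup x (M - (n + 1))
      have s2 := hSup (x + 1) (M - (n + 1))
      have ih' := ih (by omega)
      rw [show (M : ℤ) - n = M - (n + 1) + 1 by ring, s1, s2] at ih'
      simp only [hv, hh] at ih' hcl ⊢
      linear_combination ih' - hcl
  have hSright' : ∀ x y, 0 ≤ y → S (x + 1, y) = S (x, y) + h x y := by
    intro x y hy
    by_cases hyM : y ≤ M
    · have := hSright x (M - y).toNat (by omega)
      rwa [show (M : ℤ) - ((M - y).toNat : ℤ) = y by omega] at this
    · rw [(hout x y fun hp => by have := (hM _ hp).2; simp only at this; omega).2]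
      simp [hS, Finset.Ico_eq_empty (show ¬ y < (M : ℤ) by omega)]
  have hSadj : ∀ a b, G.Adj a b → 0 ≤ a.2 → 0 ≤ b.2 → S a = S b := by
    rintro ⟨a1, a2⟩ ⟨b1, b2⟩ hab ha hb
    have hCab := hC _ _ hab ha hb
    rcases squareLattice_cases (hG.le hab) with e | e | e | e <;>
      simp only [Prod.mk.injEq] at e ha hb <;> obtain ⟨rfl, rfl⟩ := e
    · rw [hSright' _ _ ha]
      simp only [hh, boundaryIndicator_eq_zero hCab, add_zero]
    · rw [hSup]
      simp only [hv, boundaryIndicator_eq_zero hCab, add_zero]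
    · rw [hSright' _ _ hb]
      simp only [hh, boundaryIndicator_eq_zero hCab.symm, add_zero]
    · rw [hSup]
      simp only [hv, boundaryIndicator_eq_zero hCab.symm, add_zero]
  -- `S` is constant along open edges, and an infinite cluster has a vertex whose upward column
  -- misses `K`.
  have hSzero : ∀ u, InfiniteIn G (halfPlane 0) u → S u = 0 := by
    intro u hu
    obtain ⟨w, hw, hwbox⟩ := hu.2.exists_notMem_finset
      (Finset.Icc ((-(M : ℤ), 0) : ℤ × ℤ) ((M : ℤ), (M : ℤ)))
    have hw0 : 0 ≤ w.2 := mem_of_inside_reachable (D := halfPlane 0) hw hu.1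
    have hSuw : S u = S w := reachable_induction (P := fun w => S u = S w) hw rfl
      fun a b _ hab ih => ih.trans (hSadj a b hab.1 hab.2.1 hab.2.2)
    rw [hSuw]
    simp only [hS]
    refine Finset.sum_eq_zero fun j hj => (hout _ _ fun hp => hwbox ?_).1
    have h3 := (hM _ hp).1
    rw [Finset.mem_Ico] at hj
    rw [Finset.mem_Icc, Prod.le_def, Prod.le_def]
    have := abs_lt.1 h3
    simp only at this ⊢
    omega
  have hbox_mem : ∀ x y : ℤ, |x| ≤ m → 0 ≤ y → y ≤ m → (x, y) ∈ K := by
    intro x y hx hy hym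
    refine hboxK ⟨Prod.le_def.2 ?_, Prod.le_def.2 ?_⟩ <;> have := abs_le.1 hx <;> simp only <;> omega
  -- Inside the box every plaquette is in `K`, so there `S` and the indicator of `C` have the same
  -- differences and their sum is constant. As `S` vanishes at `u₁` and `u₂`, both lie in `C`.
  have hT := function_eq_of_steps (T := fun p => S p + if p ∈ C then 1 else 0) (m := m)
    (fun x y hx hy hym => by
      simp only [hSup, hv, boundaryIndicator, hbox_mem x y hx hy hym, if_true]
      split_ifs <;> first | linear_combination h2 | linear_combination (0 : ZMod 2) * h2)
    (fun x hx => by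
      simp only [hSright' x 0 le_rfl, hh, boundaryIndicator,
        hbox_mem x 0 hx le_rfl ((abs_nonneg x).trans hx), if_true]
      split_ifs <;> first | linear_combination h2 | linear_combination (0 : ZMod 2) * h2)
  have a1 := abs_nonneg u₁.1
  have a2 := abs_nonneg u₁.2
  have a3 := abs_nonneg u₂.1
  have a4 := abs_nonneg u₂.2
  have t1 := hT u₁ (by omega) h₁.1 (by have := le_abs_self u₁.2; omega)
  have t2 := hT u₂ (by omega) h₂.1 (by have := le_abs_self u₂.2; omega)
  have hu₁C : u₁ ∈ C := SimpleGraph.Reachable.refl _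
  by_contra hcon
  have hu₂C : u₂ ∉ C := hcon
  rw [← t2] at t1
  simp only [hSzero u₁ h₁, hSzero u₂ h₂, hu₁C, hu₂C, if_true, if_false] at t1
  exact absurd t1 (by decide)

end Uniqueness

/-! ### Random graphs: measurability -/

section Measurability

variable {Ω V : Type*} [MeasurableSpace Ω] {G : Ω → SimpleGraph V}

/-- Reachability is a countable union over walk lengths, and each length is handled by recursion on
the first step. -/
theorem measurable_reachable [Countable V] (hG : ∀ a b, Measurable fun ω => (G ω).Adj a b) (a b : V) :
    Measurable fun ω => (G ω).Reachable a b := by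
  have h : ∀ n : ℕ, ∀ a, Measurable fun ω => ∃ p : (G ω).Walk a b, p.length = n := by
    intro n
    induction n with
    | zero =>
      intro a
      have : (fun ω => ∃ p : (G ω).Walk a b, p.length = 0) = fun _ => a = b := by
        funext ω
        refine propext ⟨fun ⟨p, hp⟩ => SimpleGraph.Walk.eq_of_length_eq_zero hp, ?_⟩
        rintro rfl
        exact ⟨.nil, rfl⟩
      rw [this]
      exact measurable_const
    | succ n ih =>
      intro a
      have : (fun ω => ∃ p : (G ω).Walk a b, p.length = n + 1) =
          fun ω => ∃ c, (G ω).Adj a c ∧ ∃ p : (G ω).Walk c b, p.length = n := by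
        funext ω
        refine propext ⟨?_, ?_⟩
        · rintro ⟨p, hp⟩
          cases p with
          | nil => simp at hp
          | cons h q => exact ⟨_, h, q, by simpa using hp⟩
        · rintro ⟨c, h, q, hq⟩
          exact ⟨.cons h q, by simp [hq]⟩
      rw [this]
      exact Measurable.exists fun c => (hG a c).and (ih c)
  have : (fun ω => (G ω).Reachable a b) = fun ω => ∃ n, ∃ p : (G ω).Walk a b, p.length = n := by
    funext ω
    exact propext ⟨fun ⟨p⟩ => ⟨_, p, rfl⟩, fun ⟨_, p, _⟩ => ⟨p⟩⟩
  rw [this]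
  exact Measurable.exists fun n => h n a

theorem measurable_inside_adj (hG : ∀ a b, Measurable fun ω => (G ω).Adj a b) (D : Set V)
    (a b : V) : Measurable fun ω => (inside (G ω) D).Adj a b :=
  (hG a b).and measurable_const

theorem measurable_inside_reachable [Countable V]
    (hG : ∀ a b, Measurable fun ω => (G ω).Adj a b) (D : Set V)
    (a b : V) : Measurable fun ω => (inside (G ω) D).Reachable a b :=
  measurable_reachable (measurable_inside_adj hG D) a b

/-- For countable `V` there are countably many finite sets, so this form of infinitude is visibly
measurable. -/
theorem infinite_iff_forall_finset {s : Set V} : s.Infinite ↔ ∀ F : Finset V, ∃ v, v ∉ F ∧ v ∈ s := by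
  refine ⟨fun h F => ?_, fun h hs => ?_⟩
  · obtain ⟨v, hv, hF⟩ := h.exists_notMem_finset F
    exact ⟨v, hF, hv⟩
  · obtain ⟨v, hv, hvs⟩ := h hs.toFinset
    exact hv (hs.mem_toFinset.2 hvs)

theorem measurable_infinite_cluster [Countable V] (hG : ∀ a b, Measurable fun ω => (G ω).Adj a b) (u : V) :
    Measurable fun ω => {v | (G ω).Reachable u v}.Infinite := by
  simp only [infinite_iff_forall_finset]
  exact Measurable.forall fun F => Measurable.exists fun v =>
    measurable_const.and (measurable_reachable hG u v)

theorem measurable_infiniteIn [Countable V]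
    (hG : ∀ a b, Measurable fun ω => (G ω).Adj a b) (D : Set V) (u : V) :
    Measurable fun ω => InfiniteIn (G ω) D u :=
  measurable_const.and (measurable_infinite_cluster (measurable_inside_adj hG D) u)

theorem measurable_isTrifurcation [Countable V]
    (hG : ∀ a b, Measurable fun ω => (G ω).Adj a b) (b : Finset V) :
    Measurable fun ω => IsTrifurcation (G ω) b := by
  have h1 := measurable_inside_reachable hG (b : Set V)
  have h2 := measurable_inside_reachable hG (b : Set V)ᶜ
  have h3 := measurable_reachable hG
  refine (measurable_const.and (Measurable.forall fun a => measurable_const.imp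
    (Measurable.forall fun c => measurable_const.imp (h1 a c)))).and (Measurable.forall fun F => ?_)
  refine Measurable.exists fun p => measurable_const.and (Measurable.exists fun q =>
    measurable_const.and (Measurable.exists fun r => measurable_const.and ?_))
  refine (Measurable.forall fun e => measurable_const.imp
    ((h3 p e).and ((h3 q e).and (h3 r e)))).and ?_
  exact (h2 p q).not.and ((h2 q r).not.and (h2 p r).not)

end Measurability

/-! ### Transport along bijections of the vertices -/

section Transport

variable {V : Type*} {G₁ G₂ : SimpleGraph V}

theorem inside_reachable_equiv (e : V ≃ V) (h : ∀ a b, G₁.Adj a b ↔ G₂.Adj (e a) (e b))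
    {D₁ D₂ : Set V} (hD : ∀ x, x ∈ D₁ ↔ e x ∈ D₂) (a b : V) :
    (inside G₁ D₁).Reachable a b ↔ (inside G₂ D₂).Reachable (e a) (e b) := by
  let f : inside G₁ D₁ ≃g inside G₂ D₂ := ⟨e, fun {a b} => by
    simp only [inside, h a b, hD]⟩
  exact (SimpleGraph.Iso.reachable_iff (φ := f)).symm

theorem reachable_equiv (e : V ≃ V) (h : ∀ a b, G₁.Adj a b ↔ G₂.Adj (e a) (e b)) (a b : V) :
    G₁.Reachable a b ↔ G₂.Reachable (e a) (e b) := by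
  let f : G₁ ≃g G₂ := ⟨e, fun {a b} => (h a b).symm⟩
  exact (SimpleGraph.Iso.reachable_iff (φ := f)).symm

theorem infinite_cluster_equiv (e : V ≃ V) (h : ∀ a b, G₁.Adj a b ↔ G₂.Adj (e a) (e b)) (u : V) :
    {v | G₁.Reachable u v}.Infinite ↔ {v | G₂.Reachable (e u) v}.Infinite := by
  have : {v | G₂.Reachable (e u) v} = e '' {v | G₁.Reachable u v} := by
    ext v
    simp only [Set.mem_image, Set.mem_ofPred_eq, reachable_equiv e h]
    exact ⟨fun hv => ⟨e.symm v, by simpa using hv, by simp⟩, by rintro ⟨w, hw, rfl⟩; exact hw⟩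
  rw [this, Set.infinite_image_iff e.injective.injOn]

theorem infiniteIn_equiv (e : V ≃ V) (h : ∀ a b, G₁.Adj a b ↔ G₂.Adj (e a) (e b))
    {D₁ D₂ : Set V} (hD : ∀ x, x ∈ D₁ ↔ e x ∈ D₂) (u : V) :
    InfiniteIn G₁ D₁ u ↔ InfiniteIn G₂ D₂ (e u) :=
  and_congr (hD u) (infinite_cluster_equiv e (fun a b => by simp only [inside, h a b, hD]) u)

theorem IsTrifurcation.map (e : V ≃ V) (h : ∀ a b, G₁.Adj a b ↔ G₂.Adj (e a) (e b))
    {b : Finset V} (hb : IsTrifurcation G₁ b) : IsTrifurcation G₂ (b.map e.toEmbedding) := by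
  have hmem : ∀ x, x ∈ (b : Set V) ↔ e x ∈ (b.map e.toEmbedding : Set V) := by
    intro x
    simp
  have hmem' : ∀ x, x ∈ (b : Set V)ᶜ ↔ e x ∈ (b.map e.toEmbedding : Set V)ᶜ :=
    fun x => not_congr (hmem x)
  refine ⟨⟨hb.1.1.map, ?_⟩, fun F => ?_⟩
  · simp only [Finset.mem_map, Equiv.coe_toEmbedding]
    rintro _ ⟨x, hx, rfl⟩ _ ⟨y, hy, rfl⟩
    exact (inside_reachable_equiv e h hmem x y).1 (hb.1.2 x hx y hy)
  · obtain ⟨p, hp, q, hq, r, hr, hre, h1, h2, h3⟩ := hb.2 (F.map e.symm.toEmbedding)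
    have hF : ∀ x, x ∈ ((F.map e.symm.toEmbedding : Finset V) : Set V)ᶜ → e x ∈ (F : Set V)ᶜ := by
      intro x hx hxF
      refine hx ?_
      simp only [Finset.coe_map, Set.mem_image, Finset.mem_coe, Equiv.coe_toEmbedding]
      exact ⟨e x, hxF, by simp⟩
    refine ⟨e p, hF p hp, e q, hF q hq, e r, hF r hr, ?_,
      fun h' => h1 ((inside_reachable_equiv e h hmem' p q).2 h'),
      fun h' => h2 ((inside_reachable_equiv e h hmem' q r).2 h'),
      fun h' => h3 ((inside_reachable_equiv e h hmem' p r).2 h')⟩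
    simp only [Finset.mem_map, Equiv.coe_toEmbedding]
    rintro _ ⟨x, hx, rfl⟩
    obtain ⟨g1, g2, g3⟩ := hre x hx
    exact ⟨(reachable_equiv e h p x).1 g1, (reachable_equiv e h q x).1 g2,
      (reachable_equiv e h r x).1 g3⟩

end Transport

/-! ### Translations and duality of configurations -/

section Configurations

theorem openGraph_adj {V : Type*} {G : SimpleGraph V} {ω : EdgeConfig G} {a b : V} :
    (openGraph ω).Adj a b ↔ ∃ h : G.Adj a b, ω ⟨s(a, b), h⟩ = true := by
  rw [openGraph, SimpleGraph.fromEdgeSet_adj]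
  exact ⟨fun h => h.1, fun h => ⟨h, h.1.ne⟩⟩

theorem measurable_openGraph_adj {V : Type*} {G : SimpleGraph V} (a b : V) :
    Measurable fun ω : EdgeConfig G => (openGraph ω).Adj a b := by
  simp only [openGraph_adj]
  by_cases h : G.Adj a b
  · simp only [h, exists_true_left]
    exact (measurable_of_finite (fun c : Bool => c = true)).comp (measurable_pi_apply _)
  · simp only [h, IsEmpty.exists_iff]
    exact measurable_const

theorem openGraph_vadd_adj (v : ℤ × ℤ) (ω : EdgeConfig squareLattice) (a b : ℤ × ℤ) :
    (openGraph (v +ᵥ ω)).Adj a b ↔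
      (openGraph ω).Adj (Equiv.addLeft (-v) a) (Equiv.addLeft (-v) b) := by
  rw [openGraph_adj, openGraph_adj]
  have h : squareLattice.Adj (Equiv.addLeft (-v) a) (Equiv.addLeft (-v) b) ↔
      squareLattice.Adj a b := (translation (-v)).map_rel_iff
  exact ⟨fun ⟨h1, h2⟩ => ⟨h.2 h1, h2⟩, fun ⟨h1, h2⟩ => ⟨h.1 h1, h2⟩⟩

theorem measurable_vadd_config (v : ℤ × ℤ) :
    Measurable fun ω : EdgeConfig squareLattice => v +ᵥ ω :=
  measurable_pi_lambda _ fun _ => measurable_pi_apply _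

theorem planarDual_openGraph (ω : EdgeConfig squareLattice) :
    PlanarDual (openGraph ω) (openGraph (dualConfig ω)) where
  le := fun _ _ h => (openGraph_adj.1 h).1
  le' := fun _ _ h => (openGraph_adj.1 h).1
  right x y := by
    have h1 : squareLattice.Adj (x, y) (x + 1, y) := by simp [squareLattice_adj]
    have h2 : squareLattice.Adj (x + 1, y) (x + 1, y + 1) := by simp [squareLattice_adj]
    have h3 : crossedEdge ⟨s((x, y), (x + 1, y)), h1⟩ = ⟨s((x + 1, y), (x + 1, y + 1)), h2⟩ := by
      apply Subtype.ext
      simp [crossedEdge, crossedSym2]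
    simp [openGraph_adj, dualConfig, h1, h2, h3]
  up x y := by
    have h1 : squareLattice.Adj (x, y) (x, y + 1) := by simp [squareLattice_adj]
    have h2 : squareLattice.Adj (x, y + 1) (x + 1, y + 1) := by simp [squareLattice_adj]
    have h3 : crossedEdge ⟨s((x, y), (x, y + 1)), h1⟩ = ⟨s((x, y + 1), (x + 1, y + 1)), h2⟩ := by
      apply Subtype.ext
      simp [crossedEdge, crossedSym2]
    simp [openGraph_adj, dualConfig, h1, h2, h3]

theorem dualConfig_vadd (v : ℤ × ℤ) (ω : EdgeConfig squareLattice) :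
    dualConfig (v +ᵥ ω) = v +ᵥ dualConfig ω := by
  funext e
  change (!ω ((translation (-v)).mapEdgeSet (crossedEdge e))) =
    !ω (crossedEdge ((translation (-v)).mapEdgeSet e))
  congr 2
  apply Subtype.ext
  obtain ⟨e, he⟩ := e
  induction e with
  | _ p q =>
    obtain ⟨a, b⟩ := p
    obtain ⟨c, d⟩ := q
    obtain ⟨i, j⟩ := v
    simp [translation, crossedEdge, crossedSym2, add_assoc]

/-- Labelling a plaquette by its lower left corner moves it by `(1/2, 1/2)`, so dualizing twice
shifts edges by `(1, 1)`. -/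
theorem dualConfig_dualConfig (ω : EdgeConfig squareLattice) :
    dualConfig (dualConfig ω) = ((-1, -1) : ℤ × ℤ) +ᵥ ω := by
  funext e
  change (!!ω (crossedEdge (crossedEdge e))) = ω ((translation (-(-1, -1))).mapEdgeSet e)
  rw [Bool.not_not]
  congr 1
  apply Subtype.ext
  obtain ⟨e, he⟩ := e
  induction e with
  | _ p q =>
    obtain ⟨a, b⟩ := p
    obtain ⟨c, d⟩ := q
    have h := squareLattice_cases he
    simp only [Prod.mk.injEq] at h
    rcases h with ⟨rfl, rfl⟩ | ⟨rfl, rfl⟩ | ⟨rfl, rfl⟩ | ⟨rfl, rfl⟩ <;>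
      simp [translation, crossedEdge, crossedSym2] <;> omega

theorem infiniteIn_halfPlane_vadd (v : ℤ × ℤ) (ω : EdgeConfig squareLattice) (y : ℤ)
    (u : ℤ × ℤ) : InfiniteIn (openGraph (v +ᵥ ω)) (halfPlane y) u ↔
      InfiniteIn (openGraph ω) (halfPlane (y - v.2)) (-v + u) :=
  infiniteIn_equiv (Equiv.addLeft (-v)) (openGraph_vadd_adj v ω) (fun x => by
    simp only [halfPlane, Set.mem_ofPred_eq, Equiv.coe_addLeft, Prod.snd_add, Prod.snd_neg]
    omega) u

end Configurations

/-! ### Consequences of translation invariance -/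

section Invariance

/-- A stationary random set of integers almost surely has no greatest element. -/
theorem ae_not_isGreatest {Ω : Type*} [MeasurableSpace Ω] {μ : Measure Ω} [IsFiniteMeasure μ]
    {τ : Ω → Ω} (hτ : MeasurePreserving τ μ μ) {J : Ω → Set ℤ}
    (hm : ∀ j, Measurable fun ω => j ∈ J ω) (hJ : ∀ ω j, j ∈ J (τ ω) ↔ j + 1 ∈ J ω) :
    ∀ᵐ ω ∂μ, ∀ j, ¬ IsGreatest (J ω) j := by
  set E : ℤ → Set Ω := fun j => {ω | IsGreatest (J ω) j} with hE
  have hEm : ∀ j, MeasurableSet (E j) := fun j => measurableSet_setOfPred.2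
    ((hm j).and (Measurable.forall fun i => (hm i).imp measurable_const))
  have hpre : ∀ j, τ ⁻¹' E j = E (j + 1) := by
    intro j
    ext ω
    simp only [hE, Set.mem_preimage, Set.mem_ofPred_eq, IsGreatest, mem_upperBounds, hJ]
    refine and_congr_right fun _ => ⟨fun h i hi => ?_, fun h i hi => ?_⟩
    · have := h (i - 1) (by simpa using hi)
      omega
    · have := h (i + 1) hi
      omega
  have hstep : ∀ j, μ (E (j + 1)) = μ (E j) := by
    intro j
    rw [← hpre, hτ.measure_preimage (hEm j).nullMeasurableSet]
  have hzero : ∀ j, μ (E j) = 0 := by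
    intro j
    have hconst : ∀ n : ℕ, μ (E (j + n)) = μ (E j) := by
      intro n
      induction n with
      | zero => simp
      | succ n ih => rw [Nat.cast_succ, ← add_assoc, hstep, ih]
    -- The events `E (j + n)` are disjoint and equally likely, which is impossible for a finite
    -- measure unless they are null.
    by_contra hne
    have hdisj : Pairwise (Function.onFun Disjoint fun n : ℕ => E (j + n)) := by
      intro n m hnm
      refine Set.disjoint_left.2 fun ω h1 h2 => hnm ?_
      have := h1.unique h2
      omega
    have hsum := measure_iUnion (μ := μ) hdisj fun n => hEm (j + n)
    simp only [hconst, ENNReal.tsum_const_eq_top_of_ne_zero hne] at hsum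
    exact measure_ne_top μ _ hsum
  refine ae_all_iff.2 fun j => ?_
  exact measure_eq_zero_iff_ae_notMem.1 (hzero j)

theorem measurePreserving_vadd_config {μ : Measure (EdgeConfig squareLattice)}
    (h : VAddInvariantMeasure (ℤ × ℤ) (EdgeConfig squareLattice) μ) (v : ℤ × ℤ) :
    MeasurePreserving (fun ω : EdgeConfig squareLattice => v +ᵥ ω) μ μ where
  measurable := measurable_vadd_config v
  map_eq := by
    ext s hs
    rw [Measure.map_apply (measurable_vadd_config v) hs]
    exact h.measure_preimage_vadd v hs

variable {μ : Measure (EdgeConfig squareLattice)} [IsProbabilityMeasure μ]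

/-- Existence of an infinite cluster in a half-plane has probability zero or one. -/
theorem infinite_cluster_zero_one
    (h_inv : VAddInvariantMeasure (ℤ × ℤ) (EdgeConfig squareLattice) μ)
    (h_erg : ErgodicVAdd (ℤ × ℤ) (EdgeConfig squareLattice) μ)
    {f : EdgeConfig squareLattice → EdgeConfig squareLattice} (hf : Measurable f)
    (hfv : ∀ (v : ℤ × ℤ) ω, f (v +ᵥ ω) = v +ᵥ f ω) :
    (∀ᵐ ω ∂μ, ∀ y, ∃ u, InfiniteIn (openGraph (f ω)) (halfPlane y) u) ∨
      (∀ᵐ ω ∂μ, ∀ y u, ¬ InfiniteIn (openGraph (f ω)) (halfPlane y) u) := by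
  set A : ℤ → Set (EdgeConfig squareLattice) :=
    fun y => {ω | ∃ u, InfiniteIn (openGraph (f ω)) (halfPlane y) u} with hA
  have hAm : ∀ y, MeasurableSet (A y) := fun y => measurableSet_setOfPred.2
    (Measurable.exists fun u => measurable_infiniteIn
      (fun a b => (measurable_openGraph_adj a b).comp hf) _ u)
  have hpre : ∀ (v : ℤ × ℤ) y, (fun ω => v +ᵥ ω) ⁻¹' A y = A (y - v.2) := by
    intro v y
    ext ω
    simp only [hA, Set.mem_preimage, Set.mem_ofPred_eq, hfv, infiniteIn_halfPlane_vadd]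
    exact ⟨fun ⟨u, hu⟩ => ⟨_, hu⟩, fun ⟨u, hu⟩ => ⟨v + u, by simpa using hu⟩⟩
  have hmeas : ∀ y, μ (A y) = μ (A 0) := by
    intro y
    have := hpre (0, y) y
    rw [sub_self] at this
    rw [← this]
    exact ((measurePreserving_vadd_config h_inv (0, y)).measure_preimage
      (hAm y).nullMeasurableSet).symm
  have hUm : MeasurableSet (⋃ y, A y) := MeasurableSet.iUnion hAm
  -- A single `A y` is not fixed by vertical translations, but the union over all heights is
  -- invariant.
  have hconst := h_erg.aeconst_of_forall_preimage_vadd_ae_eq hUm fun v => by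
    refine Filter.EventuallyEq.of_eq ?_
    rw [Set.preimage_iUnion]
    simp only [hpre]
    exact (Equiv.subRight v.2).surjective.iUnion_comp A
  rcases Filter.eventuallyConst_set.1 hconst with h1 | h0
  · left
    -- The `A y` increase to the union as `y` decreases and all have the same probability, so each
    -- has probability 1.
    have hmono : Monotone fun n : ℕ => A (-n) := by
      intro n m hnm ω ⟨u, hu⟩
      have hsub : halfPlane (-n) ⊆ halfPlane (-m) := fun x hx => by
        simp only [halfPlane, Set.mem_ofPred_eq] at hx ⊢
        omega
      exact ⟨u, hsub hu.1, hu.2.mono fun x hx => SimpleGraph.Reachable.mono (inside_mono hsub) hx⟩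
    have hUn : (⋃ n : ℕ, A (-n)) = ⋃ y, A y := by
      refine Set.Subset.antisymm (Set.iUnion_subset fun n => Set.subset_iUnion A _) ?_
      refine Set.iUnion_subset fun y ω ⟨u, hu⟩ => Set.mem_iUnion.2 ⟨(-y).toNat, u, ?_⟩
      have hsub : halfPlane y ⊆ halfPlane (-((-y).toNat : ℤ)) := fun x hx => by
        simp only [halfPlane, Set.mem_ofPred_eq] at hx ⊢
        omega
      exact ⟨hsub hu.1, hu.2.mono fun x hx => SimpleGraph.Reachable.mono (inside_mono hsub) hx⟩
    have hone : μ (⋃ y, A y) = 1 := prob_compl_eq_zero_iff hUm |>.1 (mem_ae_iff.1 h1)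
    have hlim := tendsto_measure_iUnion_atTop (μ := μ) hmono
    simp only [Function.comp_def, hmeas, hUn, hone] at hlim
    have h01 : μ (A 0) = 1 := tendsto_nhds_unique tendsto_const_nhds hlim
    refine ae_all_iff.2 fun y => ?_
    exact mem_ae_iff.2 ((prob_compl_eq_zero_iff (hAm y)).2 ((hmeas y).trans h01))
  · right
    filter_upwards [h0] with ω hω y u hu
    exact hω (Set.mem_iUnion.2 ⟨y, u, hu⟩)

/-- If there are finitely many infinite clusters, then none of them is bounded below. -/
theorem ae_not_bounded_below
    (h_inv : VAddInvariantMeasure (ℤ × ℤ) (EdgeConfig squareLattice) μ)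
    (h_fin : ∀ᵐ ω ∂μ, FinitelyManyInfiniteClusters ω) :
    ∀ᵐ ω ∂μ, ∀ u, {v | (openGraph ω).Reachable u v}.Infinite →
      ∀ y : ℤ, ∃ w, (openGraph ω).Reachable u w ∧ w.2 < y := by
  -- `J` records the negatives of the lowest heights of infinite clusters. Different heights come
  -- from different clusters, so `J` is almost surely finite; a finite nonempty set would have a
  -- greatest element.
  set J : EdgeConfig squareLattice → Set ℤ := fun ω => {j | ∃ u : ℤ × ℤ, u.2 = -j ∧
    {v | (openGraph ω).Reachable u v}.Infinite ∧ ∀ w, (openGraph ω).Reachable u w → u.2 ≤ w.2}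
    with hJ
  have hJm : ∀ j, Measurable fun ω => j ∈ J ω := fun j =>
    Measurable.exists fun u => measurable_const.and
      ((measurable_infinite_cluster measurable_openGraph_adj u).and
        (Measurable.forall fun w =>
          (measurable_reachable measurable_openGraph_adj u w).imp measurable_const))
  have hJv : ∀ ω j, j ∈ J (((0, 1) : ℤ × ℤ) +ᵥ ω) ↔ j + 1 ∈ J ω := by
    intro ω j
    set e : ℤ × ℤ ≃ ℤ × ℤ := Equiv.addLeft (-(0, 1)) with he
    have hadj := openGraph_vadd_adj (0, 1) ω
    have hsnd : ∀ u, (e u).2 = u.2 - 1 := fun u => by simp [he]; ring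
    refine e.exists_congr fun u => and_congr (by rw [hsnd]; omega)
      (and_congr (infinite_cluster_equiv e hadj u) (e.forall_congr fun w => ?_))
    rw [reachable_equiv e hadj u w, hsnd, hsnd, sub_le_sub_iff_right]
  filter_upwards [ae_not_isGreatest (measurePreserving_vadd_config h_inv (0, 1)) hJm hJv, h_fin]
    with ω hgr hfin u hu y
  by_contra! hcon
  have hne : (J ω).Nonempty := by
    obtain ⟨z, ⟨w, hw, hwz⟩, hz⟩ := Int.exists_least_of_bdd
      (P := fun z => ∃ w, (openGraph ω).Reachable u w ∧ w.2 = z)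
      ⟨y, fun z ⟨w, hw, hwz⟩ => hwz ▸ hcon w hw⟩ ⟨u.2, u, SimpleGraph.Reachable.refl _, rfl⟩
    refine ⟨-z, w, by omega, ?_, fun x hx => hwz ▸ hz x.2 ⟨x, hw.trans hx, rfl⟩⟩
    refine hu.mono fun v hv => hw.symm.trans hv
  have hJfin : (J ω).Finite := by
    choose! u hu1 hu2 hu3 using fun (j : ℤ) (hj : j ∈ J ω) => (hj : ∃ u : ℤ × ℤ, u.2 = -j ∧
      {v | (openGraph ω).Reachable u v}.Infinite ∧ ∀ w, (openGraph ω).Reachable u w → u.2 ≤ w.2)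
    refine Set.Finite.of_finite_image
      (f := fun j => (openGraph ω).connectedComponentMk (u j)) (hfin.subset ?_) ?_
    · rintro _ ⟨j, hj, rfl⟩
      refine (hu2 j hj).mono fun v hv => ?_
      simpa using (show (openGraph ω).Reachable (u j) v from hv).symm
    · intro i hi j hj hij
      have hr : (openGraph ω).Reachable (u i) (u j) := SimpleGraph.ConnectedComponent.exact hij
      have h1 := hu3 i hi _ hr
      have h2 := hu3 j hj _ hr.symm
      have h3 := hu1 i hi
      have h4 := hu1 j hj
      omega
  obtain ⟨j, hj⟩ := hJfin.exists_maximal hne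
  exact hgr j ⟨hj.1, fun i hi => by
    rcases le_total i j with h | h
    · exact h
    · exact hj.2 hi h⟩

/-- A set of integers without greatest element is unbounded if it is nonempty. -/
theorem exists_gt_of_not_isGreatest {J : Set ℤ} (hJ : ∀ j, ¬ IsGreatest J j) (hne : J.Nonempty)
    (n : ℤ) : ∃ j ∈ J, n < j := by
  by_contra! hcon
  obtain ⟨z, hz, hmax⟩ := Int.exists_greatest_of_bdd (P := fun z => z ∈ J) ⟨n, hcon⟩ hne
  exact hJ z ⟨hz, hmax⟩

end Invariance

/-! ### The Burton–Keane argument -/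

section BurtonKeane

/-- The square with side length `s` and lower left corner `v`. -/
noncomputable def square (s : ℕ) (v : ℤ × ℤ) : Finset (ℤ × ℤ) :=
  Finset.Ico v.1 (v.1 + s) ×ˢ Finset.Ico v.2 (v.2 + s)

theorem mem_square {s : ℕ} {v x : ℤ × ℤ} : x ∈ square s v ↔
    (v.1 ≤ x.1 ∧ x.1 < v.1 + s) ∧ v.2 ≤ x.2 ∧ x.2 < v.2 + s := by
  simp [square]

/-- There is a trifurcation contained in a square. -/
def HasTrifurcation (G : SimpleGraph (ℤ × ℤ)) (s : ℕ) (v : ℤ × ℤ) : Prop :=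
  ∃ b ⊆ square s v, IsTrifurcation G b

/-- Choose the three separated vertices outside `Λ`. A path from each towards `b` must enter `Λ`;
its last vertex before the first entry lies in `P` and in the same component off `b`. -/
theorem IsTrifurcation.separatesThree_boundary {V : Type*} {G : SimpleGraph V} {b Λ P : Finset V}
    (hb : IsTrifurcation G b) (hbΛ : b ⊆ Λ)
    (hP : ∀ c d, c ∉ Λ → d ∈ Λ → G.Adj c d → c ∈ P) : SeparatesThree G b P := by
  obtain ⟨p, hp, q, hq, r, hr, hre, h1, h2, h3⟩ := hb.2 Λ
  obtain ⟨e, he⟩ := hb.1.1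
  have key : ∀ p ∈ (Λ : Set V)ᶜ, G.Reachable p e →
      ∃ c ∈ P, (inside G (b : Set V)ᶜ).Reachable p c := by
    intro p hp hpe
    obtain ⟨c, d, hpc, hc, hd, hcd⟩ := exists_adj_of_reachable hpe hp (hbΛ he)
    exact ⟨c, hP c d hc hd hcd, hpc.mono (inside_mono (Set.compl_subset_compl.2 hbΛ))⟩
  obtain ⟨p', hp', hpp⟩ := key p hp (hre e he).1
  obtain ⟨q', hq', hqq⟩ := key q hq (hre e he).2.1
  obtain ⟨r', hr', hrr⟩ := key r hr (hre e he).2.2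
  have up : ∀ {x y}, (inside G (b : Set V)ᶜ).Reachable x y → G.Reachable y x :=
    fun h => (h.mono (inside_le _)).symm
  exact ⟨p', hp', q', hq', r', hr', fun e he => ⟨(up hpp).trans (hre e he).1,
    (up hqq).trans (hre e he).2.1, (up hrr).trans (hre e he).2.2⟩,
    fun h => h1 (hpp.trans (h.trans hqq.symm)), fun h => h2 (hqq.trans (h.trans hrr.symm)),
    fun h => h3 (hpp.trans (h.trans hrr.symm))⟩

open Classical in
/-- The number of squares in an `n × n` array that contain a trifurcation is at most of
the order of the boundary. -/
theorem card_hasTrifurcation_le {G : SimpleGraph (ℤ × ℤ)} (hG : G ≤ squareLattice) (s n : ℕ) :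
    ((Finset.range n ×ˢ Finset.range n).filter fun i =>
      HasTrifurcation G s (s * i.1, s * i.2)).card ≤ 4 * (s * n) + 4 := by
  set I := (Finset.range n ×ˢ Finset.range n).filter fun i =>
      HasTrifurcation G s (s * i.1, s * i.2) with hI
  have hex : ∀ i ∈ I, ∃ b, b ⊆ square s (s * i.1, s * i.2) ∧ IsTrifurcation G b :=
    fun i hi => (Finset.mem_filter.1 hi).2
  choose! b hbs hbt using hex
  have hlt : ∀ i j : ℕ, ∀ x : ℤ, (s : ℤ) * i ≤ x → x < s * j + s → i ≤ j := by
    intro i j x h1 h2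
    by_contra! hcon
    have : ((j : ℤ) + 1) ≤ i := by exact_mod_cast hcon
    nlinarith [Int.natCast_nonneg s]
  have hdis : ∀ i ∈ I, ∀ j ∈ I, i ≠ j → Disjoint (b i) (b j) := by
    intro i hi j hj hij
    refine Finset.disjoint_left.2 fun x hx hx' => hij ?_
    have h1 := mem_square.1 (hbs i hi hx)
    have h2 := mem_square.1 (hbs j hj hx')
    exact Prod.ext
      (le_antisymm (hlt _ _ _ h1.1.1 h2.1.2) (hlt _ _ _ h2.1.1 h1.1.2))
      (le_antisymm (hlt _ _ _ h1.2.1 h2.2.2) (hlt _ _ _ h2.2.1 h1.2.2))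
  have hinj : Set.InjOn b I := by
    intro i hi j hj hij
    by_contra hne
    have := hdis i hi j hj hne
    rw [hij, disjoint_self] at this
    exact (hbt j hj).1.1.ne_empty this
  set Λ := square (s * n) (0, 0) with hΛ
  -- `Q \ Λ` is a frame of width one with `(s * n + 2)² - (s * n)² = 4 * (s * n) + 4` vertices.
  set Q := square (s * n + 2) (-1, -1) with hQ
  have hΛQ : Λ ⊆ Q := by
    intro x hx
    rw [hΛ, mem_square] at hx
    rw [hQ, mem_square]
    push_cast at hx ⊢
    omega
  have hbΛ : ∀ i ∈ I, b i ⊆ Λ := by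
    intro i hi x hx
    have h1 := mem_square.1 (hbs i hi hx)
    have h2 := Finset.mem_product.1 (Finset.mem_filter.1 hi).1
    rw [Finset.mem_range, Finset.mem_range] at h2
    have hb : ∀ k : ℕ, k < n → (0 : ℤ) ≤ s * k ∧ (s : ℤ) * k + s ≤ s * n := by
      intro k hk
      have : ((k : ℤ) + 1) ≤ n := by exact_mod_cast hk
      have := Int.natCast_nonneg s
      exact ⟨by positivity, by nlinarith⟩
    have h3 := hb _ h2.1
    have h4 := hb _ h2.2
    rw [hΛ, mem_square]
    push_cast
    simp only at h1 ⊢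
    omega
  have hP : ∀ c d, c ∉ Λ → d ∈ Λ → G.Adj c d → c ∈ Q \ Λ := by
    intro c d hc hd hcd
    refine Finset.mem_sdiff.2 ⟨?_, hc⟩
    have hsq := squareLattice_cases (hG hcd)
    rw [hΛ, mem_square] at hd
    rw [hQ, mem_square]
    obtain ⟨c1, c2⟩ := c
    obtain ⟨d1, d2⟩ := d
    simp only [Prod.mk.injEq] at hsq hd ⊢
    push_cast at hd ⊢
    omega
  have hcard := card_le_of_separatesThree G I.card (I.image b) (Q \ Λ)
    (Finset.card_image_of_injOn hinj) ?_ ?_ ?_ ?_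
  · refine hcard.trans (le_of_eq ?_)
    rw [Finset.card_sdiff_of_subset hΛQ, hQ, hΛ, square, square]
    simp only [Finset.card_product, Int.card_Ico, add_sub_cancel_left, Int.toNat_natCast]
    rw [Nat.sub_eq_iff_eq_add (by nlinarith)]
    ring
  · intro x hx y hy hxy
    obtain ⟨i, hi, rfl⟩ := Finset.mem_image.1 hx
    obtain ⟨j, hj, rfl⟩ := Finset.mem_image.1 hy
    exact hdis i hi j hj fun h => hxy (h ▸ rfl)
  · intro x hx
    obtain ⟨i, hi, rfl⟩ := Finset.mem_image.1 hx
    exact (hbt i hi).1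
  · intro x hx
    obtain ⟨i, hi, rfl⟩ := Finset.mem_image.1 hx
    exact Finset.disjoint_of_subset_left (hbΛ i hi) Finset.disjoint_sdiff
  · intro x hx
    obtain ⟨i, hi, rfl⟩ := Finset.mem_image.1 hx
    exact (hbt i hi).separatesThree_boundary (hbΛ i hi) hP

theorem hasTrifurcation_vadd {v : ℤ × ℤ} {ω : EdgeConfig squareLattice} {s : ℕ} :
    HasTrifurcation (openGraph (v +ᵥ ω)) s v ↔ HasTrifurcation (openGraph ω) s (0, 0) := by
  constructor
  · rintro ⟨b, hb, hbt⟩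
    refine ⟨_, ?_, hbt.map (Equiv.addLeft (-v)) (openGraph_vadd_adj v ω)⟩
    intro x hx
    obtain ⟨y, hy, rfl⟩ := Finset.mem_map.1 hx
    have := mem_square.1 (hb hy)
    rw [mem_square]
    simp only [Equiv.coe_toEmbedding, Equiv.coe_addLeft, Prod.fst_add, Prod.snd_add, Prod.fst_neg,
      Prod.snd_neg]
    omega
  · rintro ⟨b, hb, hbt⟩
    refine ⟨_, ?_, hbt.map (Equiv.addLeft v) fun a c => ?_⟩
    · intro x hx
      obtain ⟨y, hy, rfl⟩ := Finset.mem_map.1 hx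
      have := mem_square.1 (hb hy)
      rw [mem_square]
      simp only [Equiv.coe_toEmbedding, Equiv.coe_addLeft, Prod.fst_add, Prod.snd_add]
      simp only at this
      omega
    · rw [openGraph_vadd_adj]
      simp

variable {μ : Measure (EdgeConfig squareLattice)} [IsProbabilityMeasure μ]

/-- By stationarity the expected number of squares with a trifurcation in an `n × n` array is `n²`
times a fixed probability. The deterministic bound is linear in `n`, so this probability is zero for
every side length, and every finite set fits in some square. -/
theorem ae_not_isTrifurcation
    (h_inv : VAddInvariantMeasure (ℤ × ℤ) (EdgeConfig squareLattice) μ) :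
    ∀ᵐ ω ∂μ, ∀ b, ¬ IsTrifurcation (openGraph ω) b := by
  classical
  set T : ℕ → ℤ × ℤ → Set (EdgeConfig squareLattice) :=
    fun s v => {ω | HasTrifurcation (openGraph ω) s v} with hT
  have hTm : ∀ s v, MeasurableSet (T s v) := fun s v => measurableSet_setOfPred.2
    (Measurable.exists fun b => measurable_const.and
      (measurable_isTrifurcation measurable_openGraph_adj b))
  have hTv : ∀ s v, μ (T s v) = μ (T s (0, 0)) := by
    intro s v
    rw [← (measurePreserving_vadd_config h_inv v).measure_preimage (hTm s v).nullMeasurableSet]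
    congr 1
    ext ω
    exact hasTrifurcation_vadd
  have hbound : ∀ s n : ℕ, (n * n : ℕ) * μ (T s (0, 0)) ≤ (4 * (s * n) + 4 : ℕ) := by
    intro s n
    calc (n * n : ℕ) * μ (T s (0, 0))
        = ∑ i ∈ Finset.range n ×ˢ Finset.range n, μ (T s (s * i.1, s * i.2)) := by
          simp only [hTv, Finset.sum_const, Finset.card_product, Finset.card_range, nsmul_eq_mul]
      _ = ∑ i ∈ Finset.range n ×ˢ Finset.range n,
            ∫⁻ ω, (T s (s * i.1, s * i.2)).indicator 1 ω ∂μ := by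
          simp only [lintegral_indicator_one (hTm s _)]
      _ = ∫⁻ ω, ∑ i ∈ Finset.range n ×ˢ Finset.range n,
            (T s (s * i.1, s * i.2)).indicator 1 ω ∂μ :=
          (lintegral_finsetSum _ fun i _ => measurable_one.indicator (hTm s _)).symm
      _ ≤ ∫⁻ _, (4 * (s * n) + 4 : ℕ) ∂μ := by
          refine lintegral_mono fun ω => ?_
          have h := card_hasTrifurcation_le (G := openGraph ω) (planarDual_openGraph ω).le s n
          simp only [Set.indicator_apply, Pi.one_apply, Finset.sum_boole, hT, Set.mem_ofPred_eq]
          exact_mod_cast h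
      _ = (4 * (s * n) + 4 : ℕ) := by simp
  have hzero : ∀ s v, μ (T s v) = 0 := by
    intro s v
    rw [hTv]
    set p := (μ (T s (0, 0))).toReal with hp
    have hp0 : 0 ≤ p := ENNReal.toReal_nonneg
    have hreal : ∀ n : ℕ, (n * n : ℝ) * p ≤ 4 * (s * n) + 4 := by
      intro n
      have := ENNReal.toReal_mono (ENNReal.natCast_ne_top _) (hbound s n)
      rw [ENNReal.toReal_mul, ENNReal.toReal_natCast, ENNReal.toReal_natCast] at this
      exact_mod_cast this
    have : p = 0 := by
      by_contra hne
      have hpos : 0 < p := lt_of_le_of_ne hp0 (Ne.symm hne)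
      -- From `n * p > 4 * s + 4` and `n ≥ 1` follows `n² * p > 4 * s * n + 4`.
      obtain ⟨n, hn⟩ := exists_nat_gt ((4 * s + 4) / p)
      rw [div_lt_iff₀ hpos] at hn
      have hn1 : (1 : ℝ) ≤ n := by
        have : 0 < n := by
          rcases Nat.eq_zero_or_pos n with rfl | h
          · have : (0 : ℝ) ≤ s := Nat.cast_nonneg s
            norm_num at hn
            linarith
          · exact h
        exact_mod_cast this
      nlinarith [hreal n]
    rwa [hp, ENNReal.toReal_eq_zero_iff, or_iff_left (measure_ne_top μ _)] at this
  have hall : ∀ᵐ ω ∂μ, ∀ s v, ω ∉ T s v :=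
    ae_all_iff.2 fun s => ae_all_iff.2 fun v => measure_eq_zero_iff_ae_notMem.1 (hzero s v)
  filter_upwards [hall] with ω hω b hb
  obtain ⟨s, hs⟩ : ∃ s : ℕ, ∀ x ∈ b, x.1.natAbs + x.2.natAbs ≤ s :=
    ⟨∑ x ∈ b, (x.1.natAbs + x.2.natAbs), fun x hx => Finset.single_le_sum
      (f := fun x : ℤ × ℤ => x.1.natAbs + x.2.natAbs) (fun _ _ => Nat.zero_le _) hx⟩
  refine hω (2 * s + 1) (-s, -s) ⟨b, fun x hx => ?_, hb⟩
  have := hs x hx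
  rw [mem_square]
  push_cast
  omega

end BurtonKeane

/-! ### Clusters of the marginals on the half-plane -/

section Marginals

theorem reachable_restrictConfig {V : Type*} {G : SimpleGraph V} {s : Set V} {ω : EdgeConfig G}
    {u v : s} : (openGraph (restrictConfig s ω)).Reachable u v ↔
      (inside (openGraph ω) s).Reachable u v := by
  have hadj : ∀ a b : s, (openGraph (restrictConfig s ω)).Adj a b ↔ (openGraph ω).Adj a b := by
    intro a b
    rw [openGraph_adj, openGraph_adj]
    exact ⟨fun ⟨h1, h2⟩ => ⟨h1, h2⟩, fun ⟨h1, h2⟩ => ⟨h1, h2⟩⟩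
  constructor
  · intro h
    exact reachable_induction (P := fun v : s => (inside (openGraph ω) s).Reachable u v) h
      (SimpleGraph.Reachable.refl _) fun a b _ hab ih =>
        ih.trans (SimpleGraph.Adj.reachable ⟨(hadj a b).1 hab, a.2, b.2⟩)
  · intro h
    have : ∃ hv, (openGraph (restrictConfig s ω)).Reachable u ⟨v, hv⟩ :=
      reachable_induction (P := fun v : V =>
        ∃ hv, (openGraph (restrictConfig s ω)).Reachable u ⟨v, hv⟩) h
        ⟨u.2, SimpleGraph.Reachable.refl _⟩ fun a b _ hab ⟨_, ih⟩ =>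
          ⟨hab.2.2, ih.trans (SimpleGraph.Adj.reachable ((hadj _ ⟨b, hab.2.2⟩).2 hab.1))⟩
    exact this.2

theorem infinite_restrictConfig {V : Type*} {G : SimpleGraph V} {s : Set V} {ω : EdgeConfig G}
    (u : s) : {v | (openGraph (restrictConfig s ω)).Reachable u v}.Infinite ↔
      InfiniteIn (openGraph ω) s u := by
  have : {v | (inside (openGraph ω) s).Reachable u v} =
      Subtype.val '' {v | (openGraph (restrictConfig s ω)).Reachable u v} := by
    ext v
    simp only [Set.mem_image, Set.mem_ofPred_eq, reachable_restrictConfig]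
    exact ⟨fun hv => ⟨⟨v, mem_of_inside_reachable hv u.2⟩, hv, rfl⟩,
      by rintro ⟨w, hw, rfl⟩; exact hw⟩
  rw [InfiniteIn, this, Set.infinite_image_iff Subtype.val_injective.injOn, and_iff_right u.2]

variable {V : Type*} {G : SimpleGraph V}

theorem mem_infiniteClusters {ω : EdgeConfig G} {u : V} :
    (openGraph ω).connectedComponentMk u ∈ infiniteClusters ω ↔
      {v | (openGraph ω).Reachable u v}.Infinite := by
  have : ((openGraph ω).connectedComponentMk u).supp = {v | (openGraph ω).Reachable u v} := by
    ext v
    simp [SimpleGraph.reachable_comm]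
  rw [infiniteClusters, Set.mem_ofPred_eq, this]

theorem noInfiniteCluster_iff {ω : EdgeConfig G} :
    NoInfiniteCluster ω ↔ ∀ u, ¬ {v | (openGraph ω).Reachable u v}.Infinite := by
  rw [NoInfiniteCluster, Set.eq_empty_iff_forall_notMem]
  refine ⟨fun h u hu => h _ (mem_infiniteClusters.2 hu), fun h C => ?_⟩
  induction C using SimpleGraph.ConnectedComponent.ind with
  | _ u => exact fun hu => h u (mem_infiniteClusters.1 hu)

theorem uniqueInfiniteCluster_iff {ω : EdgeConfig G} :
    UniqueInfiniteCluster ω ↔ (∃ u, {v | (openGraph ω).Reachable u v}.Infinite) ∧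
      ∀ u w, {v | (openGraph ω).Reachable u v}.Infinite →
        {v | (openGraph ω).Reachable w v}.Infinite → (openGraph ω).Reachable u w := by
  constructor
  · rintro ⟨C, hC, huniq⟩
    induction C using SimpleGraph.ConnectedComponent.ind with
    | _ u =>
      refine ⟨⟨u, mem_infiniteClusters.1 hC⟩, fun x y hx hy => ?_⟩
      exact SimpleGraph.ConnectedComponent.exact ((huniq _ (mem_infiniteClusters.2 hx)).trans
        (huniq _ (mem_infiniteClusters.2 hy)).symm)
  · rintro ⟨⟨u, hu⟩, huniq⟩
    refine ⟨_, mem_infiniteClusters.2 hu, fun C hC => ?_⟩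
    induction C using SimpleGraph.ConnectedComponent.ind with
    | _ w =>
      exact SimpleGraph.ConnectedComponent.sound (huniq w u (mem_infiniteClusters.1 hC) hu)

theorem measurable_noInfiniteCluster [Countable V] :
    Measurable fun ω : EdgeConfig G => NoInfiniteCluster ω := by
  simp only [noInfiniteCluster_iff]
  exact Measurable.forall fun u => (measurable_infinite_cluster measurable_openGraph_adj u).not

theorem measurable_uniqueInfiniteCluster [Countable V] :
    Measurable fun ω : EdgeConfig G => UniqueInfiniteCluster ω := by
  simp only [uniqueInfiniteCluster_iff]
  have h := measurable_infinite_cluster (measurable_openGraph_adj (G := G))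
  exact (Measurable.exists h).and (Measurable.forall fun u => Measurable.forall fun w =>
    (h u).imp ((h w).imp (measurable_reachable measurable_openGraph_adj u w)))

variable {μ : Measure (EdgeConfig squareLattice)}

theorem ae_halfPlaneMarginal_iff {P : EdgeConfig (squareLattice.induce upperHalfPlane) → Prop}
    (hP : Measurable P) :
    (∀ᵐ η ∂halfPlaneMarginal μ, P η) ↔ ∀ᵐ ω ∂μ, P (restrictConfig upperHalfPlane ω) :=
  ae_map_iff (measurable_restrictConfig _).aemeasurable (measurableSet_setOfPred.2 hP)

theorem ae_halfPlaneMarginal_dualMeasure_iff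
    {P : EdgeConfig (squareLattice.induce upperHalfPlane) → Prop} (hP : Measurable P) :
    (∀ᵐ η ∂halfPlaneMarginal (dualMeasure μ), P η) ↔
      ∀ᵐ ω ∂μ, P (restrictConfig upperHalfPlane (dualConfig ω)) := by
  rw [ae_halfPlaneMarginal_iff hP]
  exact ae_map_iff measurable_dualConfig.aemeasurable
    (measurableSet_setOfPred.2 (hP.comp (measurable_restrictConfig _)))

theorem noInfiniteCluster_restrictConfig {ω : EdgeConfig squareLattice}
    (h : ∀ u, ¬ InfiniteIn (openGraph ω) (halfPlane 0) u) :
    NoInfiniteCluster (restrictConfig upperHalfPlane ω) :=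
  noInfiniteCluster_iff.2 fun u hu => h u ((infinite_restrictConfig u).1 hu)

theorem uniqueInfiniteCluster_restrictConfig {ω : EdgeConfig squareLattice}
    {G' : SimpleGraph (ℤ × ℤ)} (hG : PlanarDual (openGraph ω) G')
    (hex : ∃ u, InfiniteIn (openGraph ω) (halfPlane 0) u)
    (hdual : ∀ u, ¬ InfiniteIn G' (halfPlane 0) u) :
    UniqueInfiniteCluster (restrictConfig upperHalfPlane ω) := by
  obtain ⟨u, hu⟩ := hex
  refine uniqueInfiniteCluster_iff.2 ⟨⟨⟨u, hu.1⟩, (infinite_restrictConfig _).2 hu⟩,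
    fun x y hx hy => ?_⟩
  exact reachable_restrictConfig.2 (reachable_of_no_infinite_dual hG hdual
    ((infinite_restrictConfig x).1 hx) ((infinite_restrictConfig y).1 hy))

end Marginals

/-! ### Non-coexistence -/

section NonCoexistence

/-- An infinite cluster of a half-plane is an infinite cluster of a smaller half-plane that
touches its boundary. -/
theorem InfiniteIn.exists_lowest {G : SimpleGraph (ℤ × ℤ)} {y : ℤ} {u : ℤ × ℤ}
    (hu : InfiniteIn G (halfPlane y) u) : ∃ z d, InfiniteIn G (halfPlane z) (d, z) := by
  obtain ⟨z, ⟨w, hw, hwz⟩, hz⟩ := Int.exists_least_of_bdd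
    (P := fun z => ∃ w, (inside G (halfPlane y)).Reachable u w ∧ w.2 = z)
    ⟨y, fun z ⟨w, hw, hwz⟩ => hwz ▸ mem_of_inside_reachable (D := halfPlane y) hw hu.1⟩
    ⟨u.2, u, SimpleGraph.Reachable.refl _, rfl⟩
  have hw' : w = (w.1, z) := by rw [← hwz]
  refine ⟨z, w.1, le_refl z, ?_⟩
  rw [← hw']
  -- No vertex of the cluster lies below the minimal height `z`, so its paths already stay in the
  -- half-plane above `z`.
  refine hu.2.mono fun v hv => inside_reachable_of_forall_mem (hw.symm.trans hv) fun x hx => ?_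
  exact hz x.2 ⟨x, hw.trans hx, rfl⟩

variable {μ : Measure (EdgeConfig squareLattice)} [IsProbabilityMeasure μ]

/-- If half-planes contain infinite clusters almost surely, then far to the right there are
infinite clusters that are connected to the boundary. -/
theorem ae_exists_startsRay
    (h_inv : VAddInvariantMeasure (ℤ × ℤ) (EdgeConfig squareLattice) μ)
    (h_fin : ∀ᵐ ω ∂μ, FinitelyManyInfiniteClusters ω)
    (hA : ∀ᵐ ω ∂μ, ∀ y, ∃ u, InfiniteIn (openGraph ω) (halfPlane y) u) :
    ∀ᵐ ω ∂μ, ∀ n : ℤ, ∃ x, n < x ∧ StartsRay (openGraph ω) 0 x := by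
  have hm : ∀ x, Measurable fun ω : EdgeConfig squareLattice =>
      x ∈ {x | StartsRay (openGraph ω) 0 x} := fun x =>
    (measurable_openGraph_adj _ _).and (measurable_infiniteIn measurable_openGraph_adj _ _)
  have hv : ∀ (ω : EdgeConfig squareLattice) x,
      x ∈ {x | StartsRay (openGraph (((-1, 0) : ℤ × ℤ) +ᵥ ω)) 0 x} ↔
        x + 1 ∈ {x | StartsRay (openGraph ω) 0 x} := by
    intro ω x
    simp only [Set.mem_ofPred_eq, StartsRay, openGraph_vadd_adj, infiniteIn_halfPlane_vadd]
    simp [add_comm]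
  filter_upwards [ae_not_isGreatest (measurePreserving_vadd_config h_inv (-1, 0)) hm hv, hA,
    ae_not_bounded_below h_inv h_fin] with ω hgr hA hlow n
  obtain ⟨u, hu⟩ := hA 1
  obtain ⟨w, huw, hw⟩ := hlow u
    (hu.2.mono fun v hv => SimpleGraph.Reachable.mono (inside_le _) hv) 1
  -- The first exit from the half-plane above height 1 is a vertical edge down to height 0, and it
  -- yields a ray. Stationarity then gives rays arbitrarily far to the right.
  obtain ⟨c, d, huc, hc, hd, hcd⟩ := exists_adj_of_reachable (b := (halfPlane 1)ᶜ) huw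
    (fun h => h hu.1) (fun h => absurd hw (not_lt.2 h))
  rw [compl_compl] at huc
  have hray : StartsRay (openGraph ω) 0 c.1 := by
    have hsq := squareLattice_cases ((planarDual_openGraph ω).le hcd)
    simp only [halfPlane, Set.mem_compl_iff, Set.mem_ofPred_eq, not_le] at hc hd
    obtain ⟨c1, c2⟩ := c
    obtain ⟨d1, d2⟩ := d
    simp only [Prod.mk.injEq] at hsq hc hd
    obtain rfl : c2 = 0 + 1 := by omega
    obtain rfl : d2 = 0 := by omega
    obtain rfl : c1 = d1 := by omega
    exact ⟨hcd.symm, le_refl (0 + 1 : ℤ), hu.2.mono fun v hv => huc.symm.trans hv⟩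
  obtain ⟨x, hx, hnx⟩ := exists_gt_of_not_isGreatest hgr ⟨c.1, hray⟩ n
  exact ⟨x, hnx, hx⟩

/-- If half-planes contain infinite clusters almost surely, then there are no infinite dual
clusters in half-planes. -/
theorem ae_no_infinite_dual
    (h_inv : VAddInvariantMeasure (ℤ × ℤ) (EdgeConfig squareLattice) μ)
    (h_fin : ∀ᵐ ω ∂μ, FinitelyManyInfiniteClusters ω)
    (hA : ∀ᵐ ω ∂μ, ∀ y, ∃ u, InfiniteIn (openGraph ω) (halfPlane y) u) :
    ∀ᵐ ω ∂μ, ∀ y u, ¬ InfiniteIn (openGraph (dualConfig ω)) (halfPlane y) u := by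
  have hm : ∀ d, Measurable fun ω : EdgeConfig squareLattice =>
      d ∈ {d | InfiniteIn (openGraph (dualConfig ω)) (halfPlane 0) (d, 0)} := fun d =>
    measurable_infiniteIn (fun a b => (measurable_openGraph_adj a b).comp measurable_dualConfig) _ _
  have hv : ∀ (ω : EdgeConfig squareLattice) d,
      d ∈ {d | InfiniteIn (openGraph (dualConfig (((-1, 0) : ℤ × ℤ) +ᵥ ω))) (halfPlane 0) (d, 0)} ↔
        d + 1 ∈ {d | InfiniteIn (openGraph (dualConfig ω)) (halfPlane 0) (d, 0)} := by
    intro ω d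
    simp only [Set.mem_ofPred_eq, dualConfig_vadd, infiniteIn_halfPlane_vadd]
    simp [add_comm]
  have h0 : ∀ᵐ ω ∂μ, ∀ d, ¬ InfiniteIn (openGraph (dualConfig ω)) (halfPlane 0) (d, 0) := by
    filter_upwards [ae_not_isGreatest (measurePreserving_vadd_config h_inv (-1, 0)) hm hv,
      ae_exists_startsRay h_inv h_fin hA, h_fin, ae_not_isTrifurcation h_inv]
      with ω hgr hray hfin htri d hd
    obtain ⟨b, hb⟩ := exists_trifurcation (planarDual_openGraph ω) hfin hray fun n => by
      obtain ⟨j, hj, hnj⟩ := exists_gt_of_not_isGreatest hgr ⟨d, hd⟩ n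
      exact ⟨j, hnj.le, hj⟩
    exact htri b hb
  -- Translation carries the statement from height 0 to every height `z`; `InfiniteIn.exists_lowest`
  -- then reduces an arbitrary cluster to one on a boundary line.
  have hz : ∀ᵐ ω ∂μ, ∀ z : ℤ, ∀ d,
      ¬ InfiniteIn (openGraph (dualConfig (((0, -z) : ℤ × ℤ) +ᵥ ω))) (halfPlane 0) (d, 0) :=
    ae_all_iff.2 fun z =>
      (measurePreserving_vadd_config h_inv (0, -z)).quasiMeasurePreserving.ae h0
  filter_upwards [hz] with ω hω y u hu
  obtain ⟨z, d, hd⟩ := hu.exists_lowest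
  refine hω z d ?_
  rw [dualConfig_vadd, infiniteIn_halfPlane_vadd]
  simpa using hd

end NonCoexistence

end HalfPlanePercolation

open HalfPlanePercolation in
/-- Non-coexistence of primal and dual infinite clusters in the half-plane: exactly one of the
three listed alternatives holds. `ErgodicVAdd` is ergodicity under the action of the group `ℤ²`
by translations. -/
theorem theorem1p2 (μ : Measure (EdgeConfig squareLattice)) [IsProbabilityMeasure μ]
    (h_inv : VAddInvariantMeasure (ℤ × ℤ) (EdgeConfig squareLattice) μ)
    (h_erg : ErgodicVAdd (ℤ × ℤ) (EdgeConfig squareLattice) μ)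
    (h_fin : ∀ᵐ ω ∂μ, FinitelyManyInfiniteClusters ω) :
    ∃! i : Fin 3,
      ![AlmostSurelyUnique (halfPlaneMarginal μ) ∧
          AlmostSurelyNone (halfPlaneMarginal (dualMeasure μ)),
        AlmostSurelyUnique (halfPlaneMarginal (dualMeasure μ)) ∧
          AlmostSurelyNone (halfPlaneMarginal μ),
        AlmostSurelyNone (halfPlaneMarginal μ) ∧
          AlmostSurelyNone (halfPlaneMarginal (dualMeasure μ))] i := by
  have hprob' : IsProbabilityMeasure (dualMeasure μ) :=
    Measure.isProbabilityMeasure_map measurable_dualConfig.aemeasurable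
  have hexcl : ∀ (ν : Measure (EdgeConfig squareLattice)) [IsProbabilityMeasure ν],
      AlmostSurelyUnique (halfPlaneMarginal ν) → AlmostSurelyNone (halfPlaneMarginal ν) →
        False := by
    intro ν _ h1 h2
    have : IsProbabilityMeasure (halfPlaneMarginal ν) :=
      Measure.isProbabilityMeasure_map (measurable_restrictConfig _).aemeasurable
    obtain ⟨η, ⟨C, hC, -⟩, h⟩ := (Filter.Eventually.and h1 h2).exists
    rw [NoInfiniteCluster] at h
    rw [h] at hC
    exact hC
  have hexμ := hexcl μ
  have hexμ' := hexcl (dualMeasure μ)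
  have hnone : (∀ᵐ ω ∂μ, ∀ y u, ¬ InfiniteIn (openGraph ω) (halfPlane y) u) →
      AlmostSurelyNone (halfPlaneMarginal μ) := fun h =>
    (ae_halfPlaneMarginal_iff measurable_noInfiniteCluster).2
      (h.mono fun ω hω => noInfiniteCluster_restrictConfig (hω 0))
  have hnone' : (∀ᵐ ω ∂μ, ∀ y u, ¬ InfiniteIn (openGraph (dualConfig ω)) (halfPlane y) u) →
      AlmostSurelyNone (halfPlaneMarginal (dualMeasure μ)) := fun h =>
    (ae_halfPlaneMarginal_dualMeasure_iff measurable_noInfiniteCluster).2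
      (h.mono fun ω hω => noInfiniteCluster_restrictConfig (hω 0))
  rcases infinite_cluster_zero_one h_inv h_erg measurable_id (fun _ _ => rfl) with hA | hA
  · have hdual := ae_no_infinite_dual h_inv h_fin hA
    have hN := hnone' hdual
    have hU : AlmostSurelyUnique (halfPlaneMarginal μ) := by
      refine (ae_halfPlaneMarginal_iff measurable_uniqueInfiniteCluster).2 ?_
      filter_upwards [hA, hdual] with ω h1 h2
      exact uniqueInfiniteCluster_restrictConfig (planarDual_openGraph ω) (h1 0) (h2 0)
    refine ⟨0, ⟨hU, hN⟩, fun i hi => ?_⟩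
    fin_cases i
    · rfl
    · exact (hexμ hU hi.2).elim
    · exact (hexμ hU hi.1).elim
  · have hN := hnone hA
    rcases infinite_cluster_zero_one h_inv h_erg measurable_dualConfig dualConfig_vadd
      with hB | hB
    · have hU : AlmostSurelyUnique (halfPlaneMarginal (dualMeasure μ)) := by
        refine (ae_halfPlaneMarginal_dualMeasure_iff measurable_uniqueInfiniteCluster).2 ?_
        filter_upwards [hA, hB] with ω h1 h2
        refine uniqueInfiniteCluster_restrictConfig (planarDual_openGraph (dualConfig ω)) (h2 0)
          fun u hu => ?_
        -- The dual of the dual is a translate of `ω`, which shifts the half-plane; `hA` excludes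
        -- infinite clusters at every height.
        rw [dualConfig_dualConfig, infiniteIn_halfPlane_vadd] at hu
        exact h1 _ _ hu
      refine ⟨1, ⟨hU, hN⟩, fun i hi => ?_⟩
      fin_cases i
      · exact (hexμ' hU hi.2).elim
      · rfl
      · exact (hexμ' hU hi.2).elim
    · have hN' := hnone' hB
      refine ⟨2, ⟨hN, hN'⟩, fun i hi => ?_⟩
      fin_cases i
      · exact (hexμ hi.1 hN).elim
      · exact (hexμ' hi.1 hN').elim
      · rfl
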